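/- Let $(x,y,t)$ be coordinates on $\mathbb{R}^3$ (the Heisenberg group $H^1$), let $X=\partial_x+2y\,\partial_t$, $Y=\partial_y-2x\,\partial_t$, $\Delta_{H^1}=X^2+Y^2$, and consider the critical Kohn–Laplace equation $$F:=\Delta_{H^1}u+u^3=u_{xx}+u_{yy}+4(x^2+y^2)u_{tt}+4y\,u_{xt}-4x\,u_{yt}+u^3=0,$$ together with the Lagrangian $L=\tfrac12(Xu)^2+\tfrac12(Yu)^2-\tfrac14u^4$. For a smooth vector field $W=\xi\,\partial_x+\phi\,\partial_y+\tau\,\partial_t+\eta\,\partial_u$ on an open set $M\subseteq\mathbb{R}^3\times\mathbb{R}$ (coefficients being functions of $(x,y,t,u)$) let $W^{(k)}$ be its $k$-th prolongation to jets, and let $D_x,D_y,D_t$ be the total derivatives, $\mathrm{Div}(\varphi)=D_x\varphi_1+D_y\varphi_2+D_t\varphi_3$. Call $W$ - a *Lie point symmetry* of the equation on $M$ if $W^{(2)}F=0$ at every 2-jet over $M$ at which $F=0$; - a *variational symmetry* of $\int L$ on $M$ if $W^{(1)}L+L\,(D_x\xi+D_y\phi+D_t\tau)=0$ identically on 1-jets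 over $M$; - a *divergence symmetry* of $\int L$ on $M$ *with potential* $\varphi=(\varphi_1,\varphi_2,\varphi_3)$ if $\varphi$ is a smooth function of $(x,y,t)$, $u$ and finitely many derivatives of $u$, defined on jets over $M$, and $W^{(1)}L+L\,(D_x\xi+D_y\phi+D_t\tau)=\mathrm{Div}(\varphi)$ identically on jets over $M$; and a *divergence symmetry* if such a $\varphi$ exists. **Theorem 2.** For every open $M\subseteq\mathbb{R}^3\times\mathbb{R}$, every Lie point symmetry of $\Delta_{H^1}u+u^3=0$ on $M$ is a divergence symmetry of $\int L$ on $M$. Moreover, the following eight vector fields are Lie point symmetries on $M=\mathbb{R}^3\times\mathbb{R}$: $$T=\partial_t,\quad R=y\,\partial_x-x\,\partial_y,\quad \tilde X=\partial_x-2y\,\partial_t,\quad \tilde Y=\partial_y+2x\,\partial_t,\quad Z=x\,\partial_x+y\,\partial_y+2t\,\partial_t-u\,\partial_u,$$ $$V_1=(xt-x^2y-y^3)\partial_x+(yt+x^3+xy^2)\partial_y+(t^2-(x^2+y^2)^2)\partial_t-tu\,\partial_u,$$ $$V_2=(t-4xy)\partial_x+(3x^2-y^2)\partial_y-(2yt+2x^3+2xy^2)\partial_t+2yu\,\partial_u,$$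 $$V_3=(x^2-3y^2)\partial_x+(t+4xy)\partial_y+(2xt-2x^2y-2y^3)\partial_t-2xu\,\partial_u.$$ The fields $T,R,\tilde X,\tilde Y,Z$ are variational symmetries of $\int L$, and $V_1,V_2,V_3$ are divergence symmetries of $\int L$ with potentials, respectively, $$A=(-yu^2,\;xu^2,\;-2(x^2+y^2)u^2),\qquad B=(0,\;u^2,\;-2xu^2),\qquad C=(-u^2,\;0,\;-2yu^2).$$ -/

import Mathlib

open scoped ContDiff

namespace KohnLaplace

/-! ### Jet spaces over `ℝ³` with coordinates `(x, y, t) = (p 0, p 1, p 2)` -/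

/-- Multi-indices `α = (α₀, α₁, α₂)` of order `|α| ≤ n`. -/
abbrev Idx (n : ℕ) : Type := {α : Fin 3 → ℕ // ∑ i, α i ≤ n}

instance instFintypeIdx (n : ℕ) : Fintype (Idx n) :=
  Fintype.subtype
    ((Fintype.piFinset fun _ : Fin 3 => Finset.range (n + 1)).filter fun α => ∑ i, α i ≤ n)
    (by
      intro α
      simp only [Finset.mem_filter, Fintype.mem_piFinset, Finset.mem_range, and_iff_right_iff_imp]
      intro h i
      have := Finset.single_le_sum (f := α) (fun _ _ => Nat.zero_le _) (Finset.mem_univ i)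
      omega)

/-- The multi-index `eᵢ`. -/
abbrev e (i : Fin 3) : Fin 3 → ℕ := Pi.single i 1

lemma sum_add_e_le {n : ℕ} {α : Fin 3 → ℕ} (h : ∑ j, α j ≤ n) (i : Fin 3) :
    ∑ j, (α + e i) j ≤ n + 1 := by
  simp only [Pi.add_apply, Finset.sum_add_distrib, Finset.sum_pi_single', Finset.mem_univ, if_true]
  omega

/-- The space of independent and dependent variables `((x, y, t), u)`. -/
abbrev Base : Type := (Fin 3 → ℝ) × ℝ

/-- The `n`-th jet space: points `((x, y, t), (u_α)_{|α| ≤ n})`. -/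
abbrev Jet (n : ℕ) : Type := (Fin 3 → ℝ) × (Idx n → ℝ)

/-- The natural projection `J^n → J^m` for `m ≤ n`. -/
def proj {m n : ℕ} (h : m ≤ n) (z : Jet n) : Jet m :=
  (z.1, fun α => z.2 ⟨α.1, α.2.trans h⟩)

/-- The projection `J^n → Base`, `z ↦ ((x, y, t), u)`. -/
def toBase {n : ℕ} (z : Jet n) : Base := (z.1, z.2 ⟨0, by simp⟩)

/-- The part of `J^n` lying over `M ⊆ Base`. -/
def jetsOver (n : ℕ) (M : Set Base) : Set (Jet n) := {z | toBase z ∈ M}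

/-- The coordinate `uᵢ = ∂u/∂xᵢ` on `J^1`. -/
def u₁ (i : Fin 3) (z : Jet 1) : ℝ := z.2 ⟨e i, by simp⟩

/-- The coordinate `uᵢⱼ = ∂²u/∂xᵢ∂xⱼ` on `J^2`. -/
def u₂ (i j : Fin 3) (z : Jet 2) : ℝ :=
  z.2 ⟨e i + e j, sum_add_e_le (n := 1) (by simp) j⟩

/-- The total derivative `Dᵢ P = ∂P/∂xᵢ + ∑_α u_{α + eᵢ} ∂P/∂u_α`. -/
noncomputable def D {n : ℕ} (i : Fin 3) (P : Jet n → ℝ) (z : Jet (n + 1)) : ℝ :=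
  fderiv ℝ P (proj n.le_succ z)
    (Pi.single i 1, fun α => z.2 ⟨α.1 + e i, sum_add_e_le α.2 i⟩)

/-- The total divergence of a triple of differential functions. -/
noncomputable def Div {n : ℕ} (φ : Fin 3 → Jet n → ℝ) (z : Jet (n + 1)) : ℝ :=
  ∑ i, D i (φ i) z

/-- The partial derivative `∂P/∂xᵢ` of a function on the jet space. -/
noncomputable def pdX {n : ℕ} (i : Fin 3) (P : Jet n → ℝ) (z : Jet n) : ℝ :=
  fderiv ℝ P z (Pi.single i 1, 0)

/-- The partial derivative `∂P/∂u_α` of a function on the jet space. -/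
noncomputable def pdU {n : ℕ} (α : Idx n) (P : Jet n → ℝ) (z : Jet n) : ℝ :=
  fderiv ℝ P z (0, Pi.single α 1)

/-! ### Point vector fields and their prolongations -/

/-- The coefficients of `W = ξ₀ ∂/∂x + ξ₁ ∂/∂y + ξ₂ ∂/∂t + η ∂/∂u`, functions of `((x, y, t), u)`. -/
structure PointField where
  ξ : Fin 3 → Base → ℝ
  η : Base → ℝ

namespace PointField

variable (W : PointField)

/-- `W` is a smooth vector field on `M`. -/
def SmoothOn (M : Set Base) : Prop :=
  (∀ i, ContDiffOn ℝ ∞ (W.ξ i) M) ∧ ContDiffOn ℝ ∞ W.η M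

/-- The total derivative `Dᵢ ξⱼ`, a function on `J^1`. -/
noncomputable def Dξ (i j : Fin 3) : Jet 1 → ℝ := D i fun z : Jet 0 => W.ξ j (toBase z)

/-- `ηᵢ = Dᵢ η - ∑ⱼ uⱼ Dᵢ ξⱼ`, the coefficient of `∂/∂uᵢ` in the prolongation of `W`. -/
noncomputable def η₁ (i : Fin 3) (z : Jet 1) : ℝ :=
  D i (fun z : Jet 0 => W.η (toBase z)) z - ∑ j, u₁ j z * W.Dξ i j z

/-- `ηᵢⱼ = Dⱼ ηᵢ - ∑ₖ uᵢₖ Dⱼ ξₖ`, the coefficient of `∂/∂uᵢⱼ` in the prolongation of `W`. -/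
noncomputable def η₂ (i j : Fin 3) (z : Jet 2) : ℝ :=
  D j (W.η₁ i) z - ∑ k, u₂ i k z * W.Dξ j k (proj one_le_two z)

/-- The first prolongation `W⁽¹⁾` acting on a function on `J^1`. -/
noncomputable def pr₁ (P : Jet 1 → ℝ) (z : Jet 1) : ℝ :=
  ∑ i, W.ξ i (toBase z) * pdX i P z
    + W.η (toBase z) * pdU ⟨0, by simp⟩ P z
    + ∑ i, W.η₁ i z * pdU ⟨e i, by simp⟩ P z

/-- The second prolongation `W⁽²⁾` acting on a function on `J^2`; each second-order coordinate
`uᵢⱼ = uⱼᵢ` is counted once. -/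
noncomputable def pr₂ (P : Jet 2 → ℝ) (z : Jet 2) : ℝ :=
  ∑ i, W.ξ i (toBase z) * pdX i P z
    + W.η (toBase z) * pdU ⟨0, by simp⟩ P z
    + ∑ i, W.η₁ i (proj one_le_two z) * pdU ⟨e i, by simp⟩ P z
    + ∑ i, ∑ j ∈ Finset.Ici i,
        W.η₂ i j z * pdU ⟨e i + e j, sum_add_e_le (n := 1) (by simp) j⟩ P z

/-- `W`, a vector field on `M`, generates Lie point symmetries of the second-order equation
`F = 0`: `W⁽²⁾ F` vanishes at all points of `F = 0` over `M`. -/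
def IsLiePointSymmetry (F : Jet 2 → ℝ) (M : Set Base) : Prop :=
  W.SmoothOn M ∧ ∀ z ∈ jetsOver 2 M, F z = 0 → W.pr₂ F z = 0

/-- The expression `W⁽¹⁾ L + L (D_x ξ₀ + D_y ξ₁ + D_t ξ₂)`, a function on `J^1`. -/
noncomputable def variationOf (L : Jet 1 → ℝ) (z : Jet 1) : ℝ :=
  W.pr₁ L z + L z * ∑ i, W.Dξ i i z

/-- `W`, a vector field on `M`, is a variational symmetry of `∫ L`. -/
def IsVariationalSymmetry (L : Jet 1 → ℝ) (M : Set Base) : Prop :=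
  W.SmoothOn M ∧ ∀ z ∈ jetsOver 1 M, W.variationOf L z = 0

/-- `W`, a vector field on `M`, satisfies `W⁽¹⁾ L + L Div(ξ) = Div(φ)`, where the potential `φ`
is a smooth function of `(x, y, t)`, `u` and the derivatives of `u` of order at most `n`. -/
def IsDivergenceSymmetryWith (L : Jet 1 → ℝ) (M : Set Base) {n : ℕ}
    (φ : Fin 3 → Jet n → ℝ) : Prop :=
  W.SmoothOn M ∧ (∀ i, ContDiffOn ℝ ∞ (φ i) (jetsOver n M)) ∧
    ∀ z ∈ jetsOver (n + 1) M, W.variationOf L (proj (Nat.le_add_left 1 n) z) = Div φ z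

/-- `W`, a vector field on `M`, is a divergence symmetry of `∫ L`. -/
def IsDivergenceSymmetry (L : Jet 1 → ℝ) (M : Set Base) : Prop :=
  ∃ (n : ℕ) (φ : Fin 3 → Jet n → ℝ), W.IsDivergenceSymmetryWith L M φ

end PointField

/-! ### The critical Kohn-Laplace equation on `H¹` -/

/-- The dependent variable `u` as a function on `J^0`. -/
def u₀ (z : Jet 0) : ℝ := (toBase z).2

/-- `X = ∂/∂x + 2y ∂/∂t` acting on differential functions. -/
noncomputable def X {n : ℕ} (P : Jet n → ℝ) (z : Jet (n + 1)) : ℝ :=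
  D 0 P z + 2 * z.1 1 * D 2 P z

/-- `Y = ∂/∂y - 2x ∂/∂t` acting on differential functions. -/
noncomputable def Y {n : ℕ} (P : Jet n → ℝ) (z : Jet (n + 1)) : ℝ :=
  D 1 P z - 2 * z.1 0 * D 2 P z

/-- The left-hand side `(X² + Y²) u + u³` of the critical Kohn-Laplace equation. -/
noncomputable def criticalEq (z : Jet 2) : ℝ :=
  X (X u₀) z + Y (Y u₀) z + (toBase z).2 ^ 3

/-- The Lagrangian `L = ½ (Xu)² + ½ (Yu)² - u⁴/4`. -/
noncomputable def lagrangian (z : Jet 1) : ℝ :=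
  1 / 2 * X u₀ z ^ 2 + 1 / 2 * Y u₀ z ^ 2 - (toBase z).2 ^ 4 / 4

/-- The point field `ξ ∂/∂x + φ ∂/∂y + τ ∂/∂t + η ∂/∂u` with coefficients written as functions
of `x y t u`. -/
def field (ξ φ τ η : ℝ → ℝ → ℝ → ℝ → ℝ) : PointField where
  ξ := ![fun q => ξ (q.1 0) (q.1 1) (q.1 2) q.2, fun q => φ (q.1 0) (q.1 1) (q.1 2) q.2,
    fun q => τ (q.1 0) (q.1 1) (q.1 2) q.2]
  η := fun q => η (q.1 0) (q.1 1) (q.1 2) q.2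

/-- Translations in `t`. -/
def fieldT : PointField :=
  field (fun _ _ _ _ => 0) (fun _ _ _ _ => 0) (fun _ _ _ _ => 1) (fun _ _ _ _ => 0)

/-- Rotations in the `x`-`y` plane. -/
def fieldR : PointField :=
  field (fun _ y _ _ => y) (fun x _ _ _ => -x) (fun _ _ _ _ => 0) (fun _ _ _ _ => 0)

/-- `X̃ = ∂/∂x - 2y ∂/∂t`. -/
def fieldXt : PointField :=
  field (fun _ _ _ _ => 1) (fun _ _ _ _ => 0) (fun _ y _ _ => -2 * y) (fun _ _ _ _ => 0)

/-- `Ỹ = ∂/∂y + 2x ∂/∂t`. -/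
def fieldYt : PointField :=
  field (fun _ _ _ _ => 0) (fun _ _ _ _ => 1) (fun x _ _ _ => 2 * x) (fun _ _ _ _ => 0)

/-- The dilation `Z = x ∂/∂x + y ∂/∂y + 2t ∂/∂t - u ∂/∂u`. -/
def fieldZ : PointField :=
  field (fun x _ _ _ => x) (fun _ y _ _ => y) (fun _ _ t _ => 2 * t) (fun _ _ _ u => -u)

/-- The conformal generator `V₁`. -/
def fieldV₁ : PointField :=
  field (fun x y t _ => x * t - x ^ 2 * y - y ^ 3) (fun x y t _ => y * t + x ^ 3 + x * y ^ 2)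
    (fun x y t _ => t ^ 2 - (x ^ 2 + y ^ 2) ^ 2) (fun _ _ t u => -(t * u))

/-- The conformal generator `V₂`. -/
def fieldV₂ : PointField :=
  field (fun x y t _ => t - 4 * x * y) (fun x y _ _ => 3 * x ^ 2 - y ^ 2)
    (fun x y t _ => -(2 * y * t + 2 * x ^ 3 + 2 * x * y ^ 2)) (fun _ y _ u => 2 * y * u)

/-- The conformal generator `V₃`. -/
def fieldV₃ : PointField :=
  field (fun x y _ _ => x ^ 2 - 3 * y ^ 2) (fun x y t _ => t + 4 * x * y)
    (fun x y t _ => 2 * x * t - 2 * x ^ 2 * y - 2 * y ^ 3) (fun x _ _ u => -(2 * x * u))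

/-- A potential depending only on `x y t u`, as a triple of functions on `J^0`. -/
def potential (φ : Fin 3 → ℝ → ℝ → ℝ → ℝ → ℝ) (i : Fin 3) (z : Jet 0) : ℝ :=
  φ i (z.1 0) (z.1 1) (z.1 2) (u₀ z)

/-- `A = (-yu², xu², -2(x² + y²)u²)`. -/
def potentialA : Fin 3 → Jet 0 → ℝ :=
  potential ![fun _ y _ u => -(y * u ^ 2), fun x _ _ u => x * u ^ 2,
    fun x y _ u => -2 * (x ^ 2 + y ^ 2) * u ^ 2]

/-- `B = (0, u², -2xu²)`. -/
def potentialB : Fin 3 → Jet 0 → ℝ :=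
  potential ![fun _ _ _ _ => 0, fun _ _ _ u => u ^ 2, fun x _ _ u => -2 * x * u ^ 2]

/-- `C = (-u², 0, -2yu²)`. -/
def potentialC : Fin 3 → Jet 0 → ℝ :=
  potential ![fun _ _ _ u => -u ^ 2, fun _ _ _ _ => 0, fun _ y _ u => -2 * y * u ^ 2]

end KohnLaplace

/-!
Test jets over a point of `M` turn the symmetry condition into differential equations for the
coefficients of `W` along the frame `X`, `Y`, `∂/∂u`: `(ξ, φ, τ)` is independent of `u` and is
generated by its contraction with the contact form, the frame derivatives of its horizontal part
are those of a conformal map with factor `-η_u`, and, by comparing powers of `u` in the cubic term,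
`η = u η_u` with `Δ η = 0`. Conversely these equations determine the Kohn Laplacians of
`ξ, φ, τ` and imply the symmetry condition. They reduce `W⁽¹⁾L + L Div(ξ, φ, τ)` to
`Xu · Xη + Yu · Yη`. Since `Xη` and `Yη` are linear in `u` and `Δ η = 0`, this is the divergence of
the horizontal vector field `(u/2) ((Xη) X + (Yη) Y)`, which vanishes for `T, R, X̃, Ỹ, Z` and
equals `A, B, C` for `V₁, V₂, V₃`.
-/

namespace KohnLaplace

section DerivAlong

variable {E : Type*} [NormedAddCommGroup E] [NormedSpace ℝ E]

/-- The derivative `V g` of a function `g` along a vector field `V`, both acting on a normed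
space, so that vector fields can be used as first-order differential operators. -/
noncomputable def derivAlong (V : E → E) (g : E → ℝ) (q : E) : ℝ := fderiv ℝ g q (V q)

variable {V W : E → E} {f g : E → ℝ} {q : E} {M : Set E}

lemma contDiffAt_of_mem (hM : IsOpen M) (hg : ContDiffOn ℝ ∞ g M) (hq : q ∈ M) :
    ContDiffAt ℝ ∞ g q :=
  hg.contDiffAt (hM.mem_nhds hq)

lemma differentiableAt_of_mem (hM : IsOpen M) (hg : ContDiffOn ℝ ∞ g M) (hq : q ∈ M) :
    DifferentiableAt ℝ g q :=
  (contDiffAt_of_mem hM hg hq).differentiableAt (by simp)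

lemma contDiffOn_derivAlong (hM : IsOpen M) (hV : ContDiff ℝ ∞ V) (hg : ContDiffOn ℝ ∞ g M) :
    ContDiffOn ℝ ∞ (derivAlong V g) M :=
  (hg.fderiv_of_isOpen hM (by simp)).clm_apply hV.contDiffOn

lemma derivAlong_congr (hM : IsOpen M) (hq : q ∈ M) (h : Set.EqOn f g M) :
    derivAlong V f q = derivAlong V g q := by
  rw [derivAlong, derivAlong, (h.eventuallyEq_of_mem (hM.mem_nhds hq)).fderiv_eq]

lemma derivAlong_fun_const (c : ℝ) : derivAlong V (fun _ => c) = fun _ => 0 := by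
  funext q; simp [derivAlong]

lemma derivAlong_eq_zero_of_eqOn (hM : IsOpen M) (hq : q ∈ M) (h : ∀ p ∈ M, f p = 0) :
    derivAlong V f q = 0 := by
  rw [derivAlong_congr hM hq h, derivAlong_fun_const]

lemma derivAlong_fun_neg : derivAlong V (fun p => -f p) = fun q => -derivAlong V f q := by
  funext q; simp [derivAlong]

lemma derivAlong_add (hf : DifferentiableAt ℝ f q) (hg : DifferentiableAt ℝ g q) :
    derivAlong V (fun p => f p + g p) q = derivAlong V f q + derivAlong V g q := by
  simp [derivAlong, fderiv_fun_add hf hg]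

lemma derivAlong_sub (hf : DifferentiableAt ℝ f q) (hg : DifferentiableAt ℝ g q) :
    derivAlong V (fun p => f p - g p) q = derivAlong V f q - derivAlong V g q := by
  simp [derivAlong, fderiv_fun_sub hf hg]

lemma derivAlong_mul (hf : DifferentiableAt ℝ f q) (hg : DifferentiableAt ℝ g q) :
    derivAlong V (fun p => f p * g p) q = f q * derivAlong V g q + g q * derivAlong V f q := by
  simp [derivAlong, fderiv_fun_mul hf hg]

lemma derivAlong_fun_mul (hf : Differentiable ℝ f) (hg : Differentiable ℝ g) :
    derivAlong V (fun p => f p * g p) = fun q => f q * derivAlong V g q + g q * derivAlong V f q :=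
  funext fun q => derivAlong_mul (hf q) (hg q)

lemma derivAlong_pow (hf : DifferentiableAt ℝ f q) (n : ℕ) :
    derivAlong V (fun p => f p ^ n) q = n * f q ^ (n - 1) * derivAlong V f q := by
  simp [derivAlong, fderiv_fun_pow n hf]

lemma derivAlong_comm_sub (hM : IsOpen M) (hq : q ∈ M) (hV : ContDiff ℝ ∞ V)
    (hW : ContDiff ℝ ∞ W) (hg : ContDiffOn ℝ ∞ g M) :
    derivAlong V (derivAlong W g) q - derivAlong W (derivAlong V g) q =
      derivAlong (VectorField.lieBracket ℝ V W) g q :=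
  (VectorField.fderiv_apply_lieBracket (contDiffAt_of_mem hM hg hq)
    (by simpa using ENat.LEInfty.out) (hW.differentiable (by simp) q)
    (hV.differentiable (by simp) q)).symm

/-- Differentiating the relation three times along `V` separates the powers of `c`. -/
lemma eq_of_cubic_relation (hM : IsOpen M) (hV : ContDiff ℝ ∞ V) {c k η m : E → ℝ}
    (hc : ContDiffOn ℝ ∞ c M) (hk : ContDiffOn ℝ ∞ k M) (hη : ContDiffOn ℝ ∞ η M)
    (hm : ContDiffOn ℝ ∞ m M) (Vc : ∀ q ∈ M, derivAlong V c q = 1)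
    (VVk : ∀ q ∈ M, derivAlong V (derivAlong V k) q = 0)
    (VVη : ∀ q ∈ M, derivAlong V (derivAlong V η) q = 0) (Vm : ∀ q ∈ M, derivAlong V m q = 0)
    (h : ∀ q ∈ M, k q + 3 * c q ^ 2 * η q - m q * c q ^ 3 = 0) (hq : q ∈ M) :
    η q = c q * derivAlong V η q ∧ m q = 3 * derivAlong V η q ∧ k q = 0 := by
  have d {f : E → ℝ} (hf : ContDiffOn ℝ ∞ f M) {q : E} (hq : q ∈ M) : DifferentiableAt ℝ f q :=
    differentiableAt_of_mem hM hf hq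
  have hVη := contDiffOn_derivAlong hM hV hη
  have hVk := contDiffOn_derivAlong hM hV hk
  have first : ∀ q ∈ M, derivAlong V k q
      + (3 * c q ^ 2 * derivAlong V η q + 6 * (c q * η q)) - 3 * m q * c q ^ 2 = 0 := by
    intro q hq
    have := d hc hq; have := d hk hq; have := d hη hq; have := d hm hq
    have key := derivAlong_eq_zero_of_eqOn (V := V) hM hq h
    simp (disch := fun_prop) only [derivAlong_add, derivAlong_sub, derivAlong_mul, derivAlong_pow,
      derivAlong_fun_const, Vc q hq, Vm q hq] at key
    linear_combination key
  have second : ∀ q ∈ M, η q + 2 * (c q * derivAlong V η q) - m q * c q = 0 := by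
    intro q hq
    have := d hc hq; have := d hVk hq; have := d hη hq; have := d hVη hq; have := d hm hq
    have key := derivAlong_eq_zero_of_eqOn (V := V) hM hq first
    simp (disch := fun_prop) only [derivAlong_add, derivAlong_sub, derivAlong_mul, derivAlong_pow,
      derivAlong_fun_const, Vc q hq, Vm q hq, VVk q hq, VVη q hq] at key
    linear_combination key / 6
  have third : m q = 3 * derivAlong V η q := by
    have := d hc hq; have := d hη hq; have := d hVη hq; have := d hm hq
    have key := derivAlong_eq_zero_of_eqOn (V := V) hM hq second
    simp (disch := fun_prop) only [derivAlong_add, derivAlong_sub, derivAlong_mul,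
      derivAlong_fun_const, Vc q hq, Vm q hq, VVη q hq] at key
    linear_combination -key
  refine ⟨?_, third, ?_⟩
  · linear_combination second q hq + c q * third
  · linear_combination h q hq - 3 * c q ^ 2 * second q hq - 2 * c q ^ 3 * third

end DerivAlong

/-- The vector field on the base with components `a` in the directions `(x, y, t)` and no
`∂/∂u`-component. -/
def horizontal (a : (Fin 3 → ℝ) → Fin 3 → ℝ) (q : Base) : Base := (a q.1, 0)

/-- The components `(1, 0, 2y)` of the left-invariant field `X = ∂/∂x + 2y ∂/∂t`. -/
def frameX (x : Fin 3 → ℝ) : Fin 3 → ℝ := ![1, 0, 2 * x 1]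

/-- The components `(0, 1, -2x)` of the left-invariant field `Y = ∂/∂y - 2x ∂/∂t`. -/
def frameY (x : Fin 3 → ℝ) : Fin 3 → ℝ := ![0, 1, -2 * x 0]

local notation "∂[" i "]" => derivAlong (horizontal fun _ => Pi.single i 1)

local notation "∂X" => derivAlong (horizontal frameX)

local notation "∂Y" => derivAlong (horizontal frameY)

local notation "∂U" => derivAlong (fun _ : Base => ((0, 1) : Base))

/-- The Kohn Laplacian `Δ = X² + Y²` acting on functions of `((x, y, t), u)`, with `u` as a
parameter. -/
noncomputable def baseKohnLaplacian (g : Base → ℝ) (q : Base) : ℝ :=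
  ∂X (∂X g) q + ∂Y (∂Y g) q

local notation "∂Δ" => baseKohnLaplacian

section Frame

variable {a b : (Fin 3 → ℝ) → Fin 3 → ℝ} {g : Base → ℝ} {q : Base} {M : Set Base}

lemma contDiff_horizontal (ha : ContDiff ℝ ∞ a) : ContDiff ℝ ∞ (horizontal a) :=
  (ha.comp contDiff_fst).prodMk contDiff_const

lemma contDiff_frameX : ContDiff ℝ ∞ frameX := by
  refine contDiff_pi.2 fun i => ?_
  fin_cases i
  exacts [contDiff_const, contDiff_const, contDiff_const.mul (contDiff_apply ℝ ℝ 1)]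

lemma contDiff_frameY : ContDiff ℝ ∞ frameY := by
  refine contDiff_pi.2 fun i => ?_
  fin_cases i
  exacts [contDiff_const, contDiff_const, contDiff_const.mul (contDiff_apply ℝ ℝ 0)]

lemma fderiv_frameX (x v : Fin 3 → ℝ) : fderiv ℝ frameX x v = ![0, 0, 2 * v 1] := by
  let L : (Fin 3 → ℝ) →L[ℝ] ℝ := (2 : ℝ) • ContinuousLinearMap.proj 1
  have h : HasFDerivAt frameX (ContinuousLinearMap.pi ![0, 0, L]) x := by
    refine hasFDerivAt_pi.2 fun i => ?_
    fin_cases i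
    exacts [hasFDerivAt_const _ _, hasFDerivAt_const _ _, (hasFDerivAt_apply 1 x).const_mul 2]
  ext i
  rw [h.fderiv]
  fin_cases i <;> rfl

lemma fderiv_frameY (x v : Fin 3 → ℝ) : fderiv ℝ frameY x v = ![0, 0, -2 * v 0] := by
  let L : (Fin 3 → ℝ) →L[ℝ] ℝ := (-2 : ℝ) • ContinuousLinearMap.proj 0
  have h : HasFDerivAt frameY (ContinuousLinearMap.pi ![0, 0, L]) x := by
    refine hasFDerivAt_pi.2 fun i => ?_
    fin_cases i
    exacts [hasFDerivAt_const _ _, hasFDerivAt_const _ _, (hasFDerivAt_apply 0 x).const_mul (-2)]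
  ext i
  rw [h.fderiv]
  fin_cases i <;> rfl

lemma fderiv_horizontal (ha : DifferentiableAt ℝ a q.1) (v : Base) :
    fderiv ℝ (horizontal a) q v = (fderiv ℝ a q.1 v.1, 0) := by
  have h := (ha.hasFDerivAt.comp q hasFDerivAt_fst).prodMk (hasFDerivAt_const (0 : ℝ) q)
  exact congrArg (fun L => L v) h.fderiv

lemma lieBracket_horizontal (ha : DifferentiableAt ℝ a q.1) (hb : DifferentiableAt ℝ b q.1) :
    VectorField.lieBracket ℝ (horizontal a) (horizontal b) q =
      (fderiv ℝ b q.1 (a q.1) - fderiv ℝ a q.1 (b q.1), 0) := by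
  simp [VectorField.lieBracket, fderiv_horizontal ha, fderiv_horizontal hb, horizontal]

lemma derivAlong_coord (V : Base → Base) (i : Fin 3) :
    derivAlong V (fun p => p.1 i) = fun q => (V q).1 i := by
  funext q
  exact congrArg (fun L => L (V q))
    ((ContinuousLinearMap.proj i).comp (ContinuousLinearMap.fst ℝ (Fin 3 → ℝ) ℝ)).fderiv

lemma derivAlong_snd (V : Base → Base) : derivAlong V (fun p => p.2) = fun q => (V q).2 := by
  funext q
  rw [derivAlong, fderiv_snd, ContinuousLinearMap.coe_snd']

lemma derivAlong_horizontal_eq_sum :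
    derivAlong (horizontal a) g q = ∑ i, a q.1 i * ∂[i] g q := by
  have h : horizontal a q = ∑ i, a q.1 i • horizontal (fun _ => Pi.single i 1) q := by
    simp [horizontal, Prod.ext_iff, Prod.fst_sum, Prod.snd_sum, ← Pi.single_smul,
      Finset.univ_sum_single]
  simp only [derivAlong, h, map_sum, map_smul, smul_eq_mul]

lemma derivAlong_frameX_eq : ∂X g q = ∂[0] g q + 2 * q.1 1 * ∂[2] g q := by
  simp [derivAlong_horizontal_eq_sum (a := frameX), Fin.sum_univ_three, frameX]

lemma derivAlong_frameY_eq : ∂Y g q = ∂[1] g q - 2 * q.1 0 * ∂[2] g q := by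
  simp [derivAlong_horizontal_eq_sum (a := frameY), Fin.sum_univ_three, frameY, sub_eq_add_neg]

lemma derivAlong_vertical_horizontal (hM : IsOpen M) (hq : q ∈ M) (ha : ContDiff ℝ ∞ a)
    (hg : ContDiffOn ℝ ∞ g M) :
    ∂U (derivAlong (horizontal a) g) q = derivAlong (horizontal a) (∂U g) q := by
  have h : VectorField.lieBracket ℝ (fun _ => ((0, 1) : Base)) (horizontal a) q = 0 := by
    simp [VectorField.lieBracket, fderiv_horizontal (ha.differentiable (by simp) q.1)]
  rw [← sub_eq_zero, derivAlong_comm_sub hM hq contDiff_const (contDiff_horizontal ha) hg,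
    derivAlong, h, map_zero]

lemma derivAlong_frameX_frameY_sub (hM : IsOpen M) (hq : q ∈ M) (hg : ContDiffOn ℝ ∞ g M) :
    ∂X (∂Y g) q - ∂Y (∂X g) q = -4 * ∂[2] g q := by
  have h : VectorField.lieBracket ℝ (horizontal frameX) (horizontal frameY) q =
      (-4 : ℝ) • horizontal (fun _ => Pi.single 2 1) q := by
    rw [lieBracket_horizontal (contDiff_frameX.differentiable (by simp) _)
      (contDiff_frameY.differentiable (by simp) _), fderiv_frameX, fderiv_frameY]
    ext i
    · fin_cases i <;> norm_num (decide := true) [horizontal, frameX, frameY]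
      exact Pi.single_eq_same _ _
    · simp [horizontal]
  rw [derivAlong_comm_sub hM hq (contDiff_horizontal contDiff_frameX)
    (contDiff_horizontal contDiff_frameY) hg, derivAlong, h, map_smul, smul_eq_mul, derivAlong]

lemma derivAlong_const_comm (hM : IsOpen M) (hq : q ∈ M) (hg : ContDiffOn ℝ ∞ g M)
    (i : Fin 3) (ha : ContDiff ℝ ∞ a) (h : fderiv ℝ a q.1 (Pi.single i 1) = 0) :
    ∂[i] (derivAlong (horizontal a) g) q = derivAlong (horizontal a) (∂[i] g) q := by
  have h : VectorField.lieBracket ℝ (horizontal fun _ => Pi.single i 1) (horizontal a) q = 0 := by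
    rw [lieBracket_horizontal (differentiableAt_const _) (ha.differentiable (by simp) _), h]
    simp
  rw [← sub_eq_zero, derivAlong_comm_sub hM hq (contDiff_horizontal contDiff_const)
    (contDiff_horizontal ha) hg, derivAlong, h, map_zero]

lemma contDiffOn_baseKohnLaplacian (hM : IsOpen M) (hg : ContDiffOn ℝ ∞ g M) :
    ContDiffOn ℝ ∞ (∂Δ g) M :=
  have hX := contDiff_horizontal contDiff_frameX
  have hY := contDiff_horizontal contDiff_frameY
  (contDiffOn_derivAlong hM hX (contDiffOn_derivAlong hM hX hg)).add
    (contDiffOn_derivAlong hM hY (contDiffOn_derivAlong hM hY hg))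

lemma derivAlong_vertical_baseKohnLaplacian (hM : IsOpen M) (hq : q ∈ M)
    (hg : ContDiffOn ℝ ∞ g M) : ∂U (∂Δ g) q = ∂Δ (∂U g) q := by
  have gX := contDiffOn_derivAlong hM (contDiff_horizontal contDiff_frameX) hg
  have gY := contDiffOn_derivAlong hM (contDiff_horizontal contDiff_frameY) hg
  have dXX := differentiableAt_of_mem hM
    (contDiffOn_derivAlong hM (contDiff_horizontal contDiff_frameX) gX) hq
  have dYY := differentiableAt_of_mem hM
    (contDiffOn_derivAlong hM (contDiff_horizontal contDiff_frameY) gY) hq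
  unfold baseKohnLaplacian
  rw [derivAlong_add dXX dYY, derivAlong_vertical_horizontal hM hq contDiff_frameX gX,
    derivAlong_vertical_horizontal hM hq contDiff_frameY gY,
    derivAlong_congr hM hq fun p hp => derivAlong_vertical_horizontal hM hp contDiff_frameX hg,
    derivAlong_congr hM hq fun p hp => derivAlong_vertical_horizontal hM hp contDiff_frameY hg]

lemma baseKohnLaplacian_congr {f : Base → ℝ} (hM : IsOpen M) (hq : q ∈ M) (h : Set.EqOn f g M) :
    ∂Δ f q = ∂Δ g q := by
  unfold baseKohnLaplacian
  rw [derivAlong_congr hM hq fun p hp => derivAlong_congr (V := horizontal frameX) hM hp h,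
    derivAlong_congr hM hq fun p hp => derivAlong_congr (V := horizontal frameY) hM hp h]

lemma baseKohnLaplacian_eq_zero_of_eqOn (hM : IsOpen M) (hq : q ∈ M) (h : ∀ p ∈ M, g p = 0) :
    ∂Δ g q = 0 := by
  rw [baseKohnLaplacian_congr hM hq h, baseKohnLaplacian]
  simp only [derivAlong_fun_const, add_zero]

end Frame

/-- The Kohn Laplacian `Δ = X² + Y²` acting on differential functions. -/
noncomputable def kohnLaplacian {n : ℕ} (P : Jet n → ℝ) (z : Jet (n + 2)) : ℝ :=
  X (X P) z + Y (Y P) z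

local notation "Δ" => kohnLaplacian

section Total

variable {n : ℕ} {P Q : Jet n → ℝ} {z : Jet (n + 1)} {i : Fin 3}
  {a b : (Fin 3 → ℝ) → Fin 3 → ℝ} {g : Base → ℝ} {M : Set Base}

lemma D_add (hP : DifferentiableAt ℝ P (proj n.le_succ z))
    (hQ : DifferentiableAt ℝ Q (proj n.le_succ z)) :
    D i (fun w => P w + Q w) z = D i P z + D i Q z := by
  simp [D, fderiv_fun_add hP hQ]

lemma D_sub (hP : DifferentiableAt ℝ P (proj n.le_succ z))
    (hQ : DifferentiableAt ℝ Q (proj n.le_succ z)) :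
    D i (fun w => P w - Q w) z = D i P z - D i Q z := by
  simp [D, fderiv_fun_sub hP hQ]

lemma D_mul (hP : DifferentiableAt ℝ P (proj n.le_succ z))
    (hQ : DifferentiableAt ℝ Q (proj n.le_succ z)) :
    D i (fun w => P w * Q w) z =
      P (proj n.le_succ z) * D i Q z + Q (proj n.le_succ z) * D i P z := by
  simp [D, fderiv_fun_mul hP hQ]

lemma D_const_mul (c : ℝ) (hP : DifferentiableAt ℝ P (proj n.le_succ z)) :
    D i (fun w => c * P w) z = c * D i P z := by
  simp [D, fderiv_const_mul hP]

lemma D_sum {ι : Type*} {s : Finset ι} {P : ι → Jet n → ℝ}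
    (hP : ∀ k ∈ s, DifferentiableAt ℝ (P k) (proj n.le_succ z)) :
    D i (fun w => ∑ k ∈ s, P k w) z = ∑ k ∈ s, D i (P k) z := by
  simp [D, fderiv_fun_sum hP]

lemma D_congr {U : Set (Jet n)} (hU : IsOpen U) (hz : proj n.le_succ z ∈ U)
    (h : Set.EqOn P Q U) : D i P z = D i Q z := by
  rw [D, D, (h.eventuallyEq_of_mem (hU.mem_nhds hz)).fderiv_eq]

/-- The projection `toBase` as a continuous linear map, which gives its smoothness. -/
def toBaseL (n : ℕ) : Jet n →L[ℝ] Base :=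
  (ContinuousLinearMap.fst ℝ _ _).prod
    ((ContinuousLinearMap.proj (⟨0, by simp⟩ : Idx n)).comp (ContinuousLinearMap.snd ℝ _ _))

lemma contDiff_toBase : ContDiff ℝ ∞ (toBase (n := n)) := (toBaseL n).contDiff

lemma isOpen_jetsOver (hM : IsOpen M) : IsOpen (jetsOver n M) :=
  hM.preimage (toBaseL n).continuous

lemma contDiffOn_comp_toBase (hg : ContDiffOn ℝ ∞ g M) :
    ContDiffOn ℝ ∞ (fun w : Jet n => g (toBase w)) (jetsOver n M) :=
  hg.comp contDiff_toBase.contDiffOn fun _ hw => hw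

lemma differentiableAt_comp_toBase (hM : IsOpen M) (hg : ContDiffOn ℝ ∞ g M) {z : Jet n}
    (hz : toBase z ∈ M) : DifferentiableAt ℝ (fun w : Jet n => g (toBase w)) z :=
  differentiableAt_of_mem (isOpen_jetsOver hM) (contDiffOn_comp_toBase hg) hz

lemma differentiable_u₁ (i : Fin 3) : Differentiable ℝ (u₁ i) := by
  unfold u₁; fun_prop

lemma D_coord (k : Fin 3) :
    D i (fun w : Jet n => w.1 k) z = (Pi.single i 1 : Fin 3 → ℝ) k := by
  let L : Jet n →L[ℝ] ℝ := (ContinuousLinearMap.proj k).comp (ContinuousLinearMap.fst ℝ _ _)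
  have h : HasFDerivAt (fun w : Jet n => w.1 k) L (proj n.le_succ z) := L.hasFDerivAt
  rw [D, h.fderiv]
  rfl

lemma D_u₁ (i k : Fin 3) (z : Jet 2) : D i (u₁ k) z = u₂ k i z := by
  let L : Jet 1 →L[ℝ] ℝ :=
    (ContinuousLinearMap.proj ⟨e k, by simp⟩).comp (ContinuousLinearMap.snd ℝ _ _)
  have h : HasFDerivAt (u₁ k) L (proj (Nat.le_succ 1) z) := L.hasFDerivAt
  rw [D, h.fderiv]
  rfl

lemma u₂_comm (i j : Fin 3) (z : Jet 2) : u₂ i j z = u₂ j i z := by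
  simp only [u₂, add_comm (e i)]

lemma D_comp_toBase (hg : DifferentiableAt ℝ g (toBase z)) :
    D i (fun w : Jet n => g (toBase w)) z =
      ∂[i] g (toBase z) + u₁ i (proj (Nat.le_add_left 1 n) z) * ∂U g (toBase z) := by
  have h : HasFDerivAt (fun w : Jet n => g (toBase w)) ((fderiv ℝ g (toBase z)).comp (toBaseL n))
      (proj n.le_succ z) :=
    HasFDerivAt.comp (g := g) (f := toBase) _ hg.hasFDerivAt (toBaseL n).hasFDerivAt
  have hv : toBaseL n (Pi.single i 1, fun α : Idx n => z.2 ⟨α.1 + e i, sum_add_e_le α.2 i⟩) =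
      horizontal (fun _ => Pi.single i 1) (toBase z)
        + u₁ i (proj (Nat.le_add_left 1 n) z) • (0, 1) := by
    ext j <;> simp [toBaseL, u₁, proj, horizontal]
  rw [D, h.fderiv, ContinuousLinearMap.comp_apply, hv, map_add, map_smul, smul_eq_mul, derivAlong,
    derivAlong]

lemma D_u₀ (i : Fin 3) : D i u₀ = u₁ i := by
  funext z
  refine (D_comp_toBase (g := fun p => p.2) differentiableAt_snd).trans ?_
  simp only [derivAlong_snd, horizontal, zero_add, mul_one]
  rfl

/-- The total derivative `∑ᵢ aᵢ Dᵢ` along a horizontal field; it specialises to `Dᵢ`, `X` and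
`Y`, so that the chain rules below are proved once for all of them. -/
noncomputable def totalAlong (a : (Fin 3 → ℝ) → Fin 3 → ℝ) (P : Jet n → ℝ) (z : Jet (n + 1)) : ℝ :=
  ∑ i, a z.1 i * D i P z

lemma D_eq_totalAlong (i : Fin 3) (P : Jet n → ℝ) :
    D i P = totalAlong (fun _ => Pi.single i 1) P := by
  funext z; simp [totalAlong, Pi.single_apply]

lemma X_eq_totalAlong (P : Jet n → ℝ) : X P = totalAlong frameX P := by
  funext z; simp [X, totalAlong, frameX, Fin.sum_univ_three]

lemma Y_eq_totalAlong (P : Jet n → ℝ) : Y P = totalAlong frameY P := by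
  funext z; simp [Y, totalAlong, frameY, Fin.sum_univ_three, sub_eq_add_neg]

lemma totalAlong_add (hP : DifferentiableAt ℝ P (proj n.le_succ z))
    (hQ : DifferentiableAt ℝ Q (proj n.le_succ z)) :
    totalAlong a (fun w => P w + Q w) z = totalAlong a P z + totalAlong a Q z := by
  simp only [totalAlong, D_add hP hQ, mul_add, Finset.sum_add_distrib]

lemma totalAlong_mul (hP : DifferentiableAt ℝ P (proj n.le_succ z))
    (hQ : DifferentiableAt ℝ Q (proj n.le_succ z)) :
    totalAlong a (fun w => P w * Q w) z =
      P (proj n.le_succ z) * totalAlong a Q z + Q (proj n.le_succ z) * totalAlong a P z := by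
  simp only [totalAlong, D_mul hP hQ, Finset.mul_sum, ← Finset.sum_add_distrib]
  exact Finset.sum_congr rfl fun i _ => by ring

lemma totalAlong_congr {U : Set (Jet n)} (hU : IsOpen U) (hz : proj n.le_succ z ∈ U)
    (h : Set.EqOn P Q U) : totalAlong a P z = totalAlong a Q z := by
  simp only [totalAlong, D_congr hU hz h]

lemma totalAlong_comp_toBase (hg : DifferentiableAt ℝ g (toBase z)) :
    totalAlong a (fun w : Jet n => g (toBase w)) z =
      derivAlong (horizontal a) g (toBase z)
        + totalAlong a u₀ (proj (Nat.le_add_left 1 n) z) * ∂U g (toBase z) := by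
  simp only [totalAlong, D_comp_toBase hg, D_u₀, derivAlong_horizontal_eq_sum (a := a), mul_add,
    Finset.sum_add_distrib, Finset.sum_mul, mul_assoc]
  rfl

lemma differentiable_totalAlong_u₀ (ha : ContDiff ℝ ∞ a) : Differentiable ℝ (totalAlong a u₀) := by
  have h : Differentiable ℝ a := ha.differentiable (by simp)
  have := differentiable_u₁
  unfold totalAlong
  simp only [D_u₀]
  fun_prop

lemma totalAlong_totalAlong_comp_toBase {z : Jet 2} (hM : IsOpen M) (ha : ContDiff ℝ ∞ a)
    (hg : ContDiffOn ℝ ∞ g M) (hz : toBase z ∈ M) :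
    totalAlong b (totalAlong a fun w : Jet 0 => g (toBase w)) z =
      derivAlong (horizontal b) (derivAlong (horizontal a) g) (toBase z)
        + totalAlong a u₀ (proj one_le_two z) * derivAlong (horizontal b) (∂U g) (toBase z)
        + totalAlong b u₀ (proj one_le_two z) * derivAlong (horizontal a) (∂U g) (toBase z)
        + totalAlong a u₀ (proj one_le_two z) * totalAlong b u₀ (proj one_le_two z)
          * ∂U (∂U g) (toBase z)
        + totalAlong b (totalAlong a u₀) z * ∂U g (toBase z) := by
  have ga := contDiffOn_derivAlong hM (contDiff_horizontal ha) hg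
  have gU := contDiffOn_derivAlong hM (V := fun _ => ((0, 1) : Base)) contDiff_const hg
  have hz' : toBase (proj (Nat.le_succ 1) z) ∈ M := hz
  have da := differentiableAt_comp_toBase hM ga hz'
  have dU := differentiableAt_comp_toBase hM gU hz'
  have du := differentiable_totalAlong_u₀ ha (proj (Nat.le_succ 1) z)
  rw [totalAlong_congr (isOpen_jetsOver hM) hz'
      (Q := fun w => derivAlong (horizontal a) g (toBase w) + totalAlong a u₀ w * ∂U g (toBase w))
      fun w hw => totalAlong_comp_toBase (n := 0) (differentiableAt_of_mem hM hg hw),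
    totalAlong_add da (du.fun_mul dU), totalAlong_mul du dU,
    totalAlong_comp_toBase (differentiableAt_of_mem hM ga hz),
    totalAlong_comp_toBase (differentiableAt_of_mem hM gU hz),
    derivAlong_vertical_horizontal hM hz ha hg]
  change _ + totalAlong b u₀ (proj one_le_two z) * _ + (totalAlong a u₀ (proj one_le_two z) *
    (_ + totalAlong b u₀ (proj one_le_two z) * _) + ∂U g (toBase z) * _) = _
  ring

lemma differentiableAt_D_comp_toBase (hM : IsOpen M) (hg : ContDiffOn ℝ ∞ g M) {z : Jet 1}
    (hz : toBase z ∈ M) (i : Fin 3) :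
    DifferentiableAt ℝ (D i fun w : Jet 0 => g (toBase w)) z := by
  have gx := contDiffOn_derivAlong hM
    (contDiff_horizontal (a := fun _ => Pi.single i 1) contDiff_const) hg
  have gu := contDiffOn_derivAlong hM (V := fun _ => ((0, 1) : Base)) contDiff_const hg
  refine ((differentiableAt_comp_toBase hM gx hz).fun_add ((differentiable_u₁ i z).fun_mul
    (differentiableAt_comp_toBase hM gu hz))).congr_of_eventuallyEq ?_
  exact Filter.eventuallyEq_of_mem ((isOpen_jetsOver hM).mem_nhds hz)
    fun w hw => D_comp_toBase (differentiableAt_of_mem hM hg hw)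

lemma D_D_comm_comp_toBase {z : Jet 2} (hM : IsOpen M) (hg : ContDiffOn ℝ ∞ g M)
    (hz : toBase z ∈ M) (i j : Fin 3) :
    D i (D j fun w : Jet 0 => g (toBase w)) z = D j (D i fun w : Jet 0 => g (toBase w)) z := by
  have expand (i j : Fin 3) := totalAlong_totalAlong_comp_toBase (a := fun _ => Pi.single i 1)
    (b := fun _ => Pi.single j 1) hM contDiff_const hg hz
  simp only [← D_eq_totalAlong, D_u₀, D_u₁] at expand
  rw [expand, expand, u₂_comm i j,
    derivAlong_const_comm hM hz hg i contDiff_const (by simp)]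
  ring

lemma X_comp_toBase (hg : DifferentiableAt ℝ g (toBase z)) :
    X (fun w : Jet n => g (toBase w)) z =
      ∂X g (toBase z) + X u₀ (proj (Nat.le_add_left 1 n) z) * ∂U g (toBase z) := by
  rw [X_eq_totalAlong, X_eq_totalAlong, totalAlong_comp_toBase hg]

lemma Y_comp_toBase (hg : DifferentiableAt ℝ g (toBase z)) :
    Y (fun w : Jet n => g (toBase w)) z =
      ∂Y g (toBase z) + Y u₀ (proj (Nat.le_add_left 1 n) z) * ∂U g (toBase z) := by
  rw [Y_eq_totalAlong, Y_eq_totalAlong, totalAlong_comp_toBase hg]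

lemma kohnLaplacian_comp_toBase {z : Jet 2} (hM : IsOpen M) (hg : ContDiffOn ℝ ∞ g M)
    (hz : toBase z ∈ M) :
    Δ (fun w : Jet 0 => g (toBase w)) z =
      ∂Δ g (toBase z)
        + 2 * (X u₀ (proj one_le_two z) * ∂X (∂U g) (toBase z)
          + Y u₀ (proj one_le_two z) * ∂Y (∂U g) (toBase z))
        + (X u₀ (proj one_le_two z) ^ 2 + Y u₀ (proj one_le_two z) ^ 2) * ∂U (∂U g) (toBase z)
        + Δ u₀ z * ∂U g (toBase z) := by
  simp only [kohnLaplacian, baseKohnLaplacian, X_eq_totalAlong, Y_eq_totalAlong,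
    totalAlong_totalAlong_comp_toBase hM contDiff_frameX hg hz,
    totalAlong_totalAlong_comp_toBase hM contDiff_frameY hg hz]
  ring

lemma D_X {z : Jet (n + 2)} (hP : ∀ j, DifferentiableAt ℝ (D j P) (proj (n + 1).le_succ z)) :
    D i (X P) z = D i (D 0 P) z + 2 * (z.1 1 * D i (D 2 P) z
      + D 2 P (proj (n + 1).le_succ z) * (Pi.single i 1 : Fin 3 → ℝ) 1) := by
  have hx : DifferentiableAt ℝ (fun w : Jet (n + 1) => 2 * w.1 1) (proj (n + 1).le_succ z) := by
    fun_prop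
  unfold X
  rw [D_add (hP 0) (hx.fun_mul (hP 2)), D_mul hx (hP 2), D_const_mul 2 (by fun_prop), D_coord]
  simp only [proj]
  ring

lemma D_Y {z : Jet (n + 2)} (hP : ∀ j, DifferentiableAt ℝ (D j P) (proj (n + 1).le_succ z)) :
    D i (Y P) z = D i (D 1 P) z - 2 * (z.1 0 * D i (D 2 P) z
      + D 2 P (proj (n + 1).le_succ z) * (Pi.single i 1 : Fin 3 → ℝ) 0) := by
  have hx : DifferentiableAt ℝ (fun w : Jet (n + 1) => 2 * w.1 0) (proj (n + 1).le_succ z) := by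
    fun_prop
  unfold Y
  rw [D_sub (hP 1) (hx.fun_mul (hP 2)), D_mul hx (hP 2), D_const_mul 2 (by fun_prop), D_coord]
  simp only [proj]
  ring

lemma kohnLaplacian_eq {z : Jet (n + 2)}
    (hP : ∀ j, DifferentiableAt ℝ (D j P) (proj (n + 1).le_succ z))
    (comm : ∀ i j, D i (D j P) z = D j (D i P) z) :
    Δ P z = D 0 (D 0 P) z + D 1 (D 1 P) z + 4 * (z.1 0 ^ 2 + z.1 1 ^ 2) * D 2 (D 2 P) z
      + 4 * z.1 1 * D 2 (D 0 P) z - 4 * z.1 0 * D 2 (D 1 P) z := by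
  rw [kohnLaplacian, X, Y, D_X hP, D_X hP, D_Y hP, D_Y hP, comm 0 2, comm 1 2]
  simp
  ring

lemma kohnLaplacian_u₀ (z : Jet 2) :
    Δ u₀ z = u₂ 0 0 z + u₂ 1 1 z + 4 * (z.1 0 ^ 2 + z.1 1 ^ 2) * u₂ 2 2 z
      + 4 * z.1 1 * u₂ 0 2 z - 4 * z.1 0 * u₂ 1 2 z := by
  rw [kohnLaplacian_eq (by simp only [D_u₀]; exact fun j => differentiable_u₁ j _)
    (by simp only [D_u₀, D_u₁]; exact fun i j => u₂_comm j i z)]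
  simp only [D_u₀, D_u₁]

lemma Div_frame (hP : DifferentiableAt ℝ P (proj n.le_succ z))
    (hQ : DifferentiableAt ℝ Q (proj n.le_succ z)) :
    Div (fun i w => P w * frameX w.1 i + Q w * frameY w.1 i) z = X P z + Y Q z := by
  have hx (k) : DifferentiableAt ℝ (fun w : Jet n => w.1 k) (proj n.le_succ z) := by fun_prop
  have h₂ : D 2 (fun w => P w * (2 * w.1 1) + Q w * (-2 * w.1 0)) z =
      2 * z.1 1 * D 2 P z - 2 * z.1 0 * D 2 Q z := by
    rw [D_add (by fun_prop) (by fun_prop), D_mul hP (by fun_prop), D_mul hQ (by fun_prop),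
      D_const_mul 2 (hx 1), D_const_mul (-2) (hx 0), D_coord, D_coord]
    simp [proj]
    ring
  simp only [Div, Fin.sum_univ_three, frameX, frameY, Matrix.cons_val, mul_one, mul_zero,
    add_zero, zero_add, h₂, X, Y]
  ring

end Total

section Coordinates

lemma criticalEq_eq_kohnLaplacian (z : Jet 2) : criticalEq z = Δ u₀ z + (toBase z).2 ^ 3 := rfl

lemma X_u₀ (z : Jet 1) : X u₀ z = u₁ 0 z + 2 * z.1 1 * u₁ 2 z := by
  rw [X, D_u₀, D_u₀]

lemma Y_u₀ (z : Jet 1) : Y u₀ z = u₁ 1 z - 2 * z.1 0 * u₁ 2 z := by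
  rw [Y, D_u₀, D_u₀]

lemma X_u₁ (k : Fin 3) (z : Jet 2) : X (u₁ k) z = u₂ k 0 z + 2 * z.1 1 * u₂ k 2 z := by
  rw [X, D_u₁, D_u₁]

lemma Y_u₁ (k : Fin 3) (z : Jet 2) : Y (u₁ k) z = u₂ k 1 z - 2 * z.1 0 * u₂ k 2 z := by
  rw [Y, D_u₁, D_u₁]

lemma fderiv_eq_of_hasDerivAt {F : Type*} [NormedAddCommGroup F] [NormedSpace ℝ F] {P : F → ℝ}
    {z v : F} {c : ℝ} (hP : DifferentiableAt ℝ P z)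
    (h : HasDerivAt (fun s : ℝ => P (z + s • v)) c 0) : fderiv ℝ P z v = c := by
  rw [← hP.lineDeriv_eq_fderiv]
  exact h.deriv

lemma hasDerivAt_affine (a b : ℝ) : HasDerivAt (fun s : ℝ => a + s * b) b 0 := by
  simpa using ((hasDerivAt_id (0 : ℝ)).mul_const b).const_add a

lemma fderiv_criticalEq (z v : Jet 2) : fderiv ℝ criticalEq z v =
    u₂ 0 0 v + u₂ 1 1 v + 4 * (z.1 0 ^ 2 + z.1 1 ^ 2) * u₂ 2 2 v
      + 4 * z.1 1 * u₂ 0 2 v - 4 * z.1 0 * u₂ 1 2 v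
      + 4 * v.1 1 * X (u₁ 2) z - 4 * v.1 0 * Y (u₁ 2) z + 3 * (toBase z).2 ^ 2 * (toBase v).2 := by
  have criticalEq_eq : criticalEq = fun z => u₂ 0 0 z + u₂ 1 1 z
      + 4 * (z.1 0 ^ 2 + z.1 1 ^ 2) * u₂ 2 2 z + 4 * z.1 1 * u₂ 0 2 z - 4 * z.1 0 * u₂ 1 2 z
      + (toBase z).2 ^ 3 :=
    funext fun z => by rw [criticalEq_eq_kohnLaplacian, kohnLaplacian_u₀]
  have hu (i j) : HasDerivAt (fun s : ℝ => u₂ i j (z + s • v)) (u₂ i j v) 0 :=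
    hasDerivAt_affine _ _
  have hx (i) : HasDerivAt (fun s : ℝ => (z + s • v).1 i) (v.1 i) 0 := hasDerivAt_affine _ _
  have hb : HasDerivAt (fun s : ℝ => (toBase (z + s • v)).2) (toBase v).2 0 :=
    hasDerivAt_affine _ _
  rw [criticalEq_eq]
  refine fderiv_eq_of_hasDerivAt (by unfold u₂ toBase; fun_prop)
    ((((((hu 0 0).add (hu 1 1)).add (((((hx 0).pow 2).add ((hx 1).pow 2)).const_mul 4).mul
      (hu 2 2))).add (((hx 1).const_mul 4).mul (hu 0 2))).sub
      (((hx 0).const_mul 4).mul (hu 1 2))).add (hb.pow 3) |>.congr_deriv ?_)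
  simp [X_u₁, Y_u₁, u₂_comm 2]
  ring

lemma fderiv_lagrangian (z v : Jet 1) : fderiv ℝ lagrangian z v =
    X u₀ z * (u₁ 0 v + 2 * z.1 1 * u₁ 2 v + 2 * v.1 1 * u₁ 2 z)
      + Y u₀ z * (u₁ 1 v - 2 * z.1 0 * u₁ 2 v - 2 * v.1 0 * u₁ 2 z)
      - (toBase z).2 ^ 3 * (toBase v).2 := by
  have lagrangian_eq : lagrangian = fun z => 1 / 2 * (u₁ 0 z + 2 * z.1 1 * u₁ 2 z) ^ 2
      + 1 / 2 * (u₁ 1 z - 2 * z.1 0 * u₁ 2 z) ^ 2 - (toBase z).2 ^ 4 / 4 :=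
    funext fun z => by rw [lagrangian, X_u₀, Y_u₀]
  have hu (i) : HasDerivAt (fun s : ℝ => u₁ i (z + s • v)) (u₁ i v) 0 := hasDerivAt_affine _ _
  have hx (i) : HasDerivAt (fun s : ℝ => (z + s • v).1 i) (v.1 i) 0 := hasDerivAt_affine _ _
  have hb : HasDerivAt (fun s : ℝ => (toBase (z + s • v)).2) (toBase v).2 0 :=
    hasDerivAt_affine _ _
  rw [lagrangian_eq]
  refine fderiv_eq_of_hasDerivAt (by unfold u₁ toBase; fun_prop)
    (((((hu 0).add (((hx 1).const_mul 2).mul (hu 2))).pow 2).const_mul (1 / 2)).add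
      ((((hu 1).sub (((hx 0).const_mul 2).mul (hu 2))).pow 2).const_mul (1 / 2)) |>.sub
      ((hb.pow 4).div_const 4) |>.congr_deriv ?_)
  simp [X_u₀, Y_u₀]
  ring

lemma u₁_single (i : Fin 3) (α : Idx 1) (x : Fin 3 → ℝ) :
    u₁ i (x, Pi.single α 1) = if e i = α.1 then 1 else 0 := by
  simp [u₁, Pi.single_apply, Subtype.ext_iff]

lemma u₂_single (i j : Fin 3) (α : Idx 2) (x : Fin 3 → ℝ) :
    u₂ i j (x, Pi.single α 1) = if e i + e j = α.1 then 1 else 0 := by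
  simp [u₂, Pi.single_apply, Subtype.ext_iff]

lemma toBase_single {n : ℕ} (α : Idx n) (x : Fin 3 → ℝ) :
    (toBase (x, Pi.single α 1)).2 = if 0 = α.1 then 1 else 0 := by
  simp [toBase, Pi.single_apply, Subtype.ext_iff]

lemma u₁_zero (i : Fin 3) (x : Fin 3 → ℝ) : u₁ i (x, 0) = 0 := rfl

lemma u₂_zero (i j : Fin 3) (x : Fin 3 → ℝ) : u₂ i j (x, 0) = 0 := rfl

lemma toBase_zero {n : ℕ} (x : Fin 3 → ℝ) : (toBase ((x, 0) : Jet n)).2 = 0 := rfl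

end Coordinates

namespace PointField

section Prolongation

variable {W : PointField} {M : Set Base}

lemma pr₂_criticalEq (z : Jet 2) : W.pr₂ criticalEq z =
    W.η₂ 0 0 z + W.η₂ 1 1 z + 4 * (z.1 0 ^ 2 + z.1 1 ^ 2) * W.η₂ 2 2 z
      + 4 * z.1 1 * W.η₂ 0 2 z - 4 * z.1 0 * W.η₂ 1 2 z
      + 4 * W.ξ 1 (toBase z) * X (u₁ 2) z - 4 * W.ξ 0 (toBase z) * Y (u₁ 2) z
      + 3 * (toBase z).2 ^ 2 * W.η (toBase z) := by
  have h0 : Finset.Ici (0 : Fin 3) = {0, 1, 2} := rfl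
  have h1 : Finset.Ici (1 : Fin 3) = {1, 2} := rfl
  have h2 : Finset.Ici (2 : Fin 3) = {2} := rfl
  have hne (i j : Fin 3) : 0 ≠ e i + e j := by decide +revert
  have hne' (i j k : Fin 3) : e i + e j ≠ e k := by decide +revert
  simp only [pr₂, pdX, pdU, fderiv_criticalEq, Fin.sum_univ_three, h0, h1, h2, u₂_single,
    toBase_single, u₂_zero, toBase_zero, hne, hne', (hne _ _).symm]
  simp (decide := true)
  ring

lemma pr₁_lagrangian (z : Jet 1) : W.pr₁ lagrangian z =
    X u₀ z * (W.η₁ 0 z + 2 * z.1 1 * W.η₁ 2 z + 2 * W.ξ 1 (toBase z) * u₁ 2 z)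
      + Y u₀ z * (W.η₁ 1 z - 2 * z.1 0 * W.η₁ 2 z - 2 * W.ξ 0 (toBase z) * u₁ 2 z)
      - (toBase z).2 ^ 3 * W.η (toBase z) := by
  have hz (i : Fin 3) : 0 ≠ e i := by decide +revert
  simp only [pr₁, pdX, pdU, fderiv_lagrangian, Fin.sum_univ_three, u₁_single,
    toBase_single, u₁_zero, toBase_zero, hz, (hz _).symm]
  simp (decide := true)
  ring

lemma η₂_eq (hM : IsOpen M) (hW : W.SmoothOn M) {z : Jet 2} (hz : toBase z ∈ M) (i j : Fin 3) :
    W.η₂ i j z = D j (D i fun w : Jet 0 => W.η (toBase w)) z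
      - ∑ k, (u₁ k (proj one_le_two z) * D j (D i fun w : Jet 0 => W.ξ k (toBase w)) z
          + W.Dξ i k (proj one_le_two z) * u₂ k j z)
      - ∑ k, u₂ i k z * W.Dξ j k (proj one_le_two z) := by
  have hz' : toBase (proj (Nat.le_succ 1) z) ∈ M := hz
  have hη := differentiableAt_D_comp_toBase hM hW.2 hz' i
  have hξ k := differentiableAt_D_comp_toBase hM (hW.1 k) hz' i
  have hm k := (differentiable_u₁ k _).fun_mul (hξ k)
  unfold η₂ η₁ Dξ
  rw [D_sub hη (DifferentiableAt.fun_sum fun k _ => hm k), D_sum fun k _ => hm k]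
  simp only [D_mul (differentiable_u₁ _ _) (hξ _), D_u₁]

lemma pr₂_criticalEq_eq (hM : IsOpen M) (hW : W.SmoothOn M) {z : Jet 2} (hz : toBase z ∈ M) :
    W.pr₂ criticalEq z =
      Δ (fun w : Jet 0 => W.η (toBase w)) z
        - ∑ k, (u₁ k (proj one_le_two z) * Δ (fun w : Jet 0 => W.ξ k (toBase w)) z
          + 2 * (X (fun w : Jet 0 => W.ξ k (toBase w)) (proj one_le_two z) * X (u₁ k) z
            + Y (fun w : Jet 0 => W.ξ k (toBase w)) (proj one_le_two z) * Y (u₁ k) z))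
        + 4 * W.ξ 1 (toBase z) * X (u₁ 2) z - 4 * W.ξ 0 (toBase z) * Y (u₁ 2) z
        + 3 * (toBase z).2 ^ 2 * W.η (toBase z) := by
  have hz' : toBase (proj (Nat.le_succ 1) z) ∈ M := hz
  have lap {g : Base → ℝ} (hg : ContDiffOn ℝ ∞ g M) :=
    kohnLaplacian_eq (differentiableAt_D_comp_toBase hM hg hz') (D_D_comm_comp_toBase hM hg hz)
  rw [pr₂_criticalEq, lap hW.2]
  simp only [η₂_eq hM hW hz, Dξ, Fin.sum_univ_three, lap (hW.1 _), X, Y, D_u₁, proj,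
    u₂_comm 1 0, u₂_comm 2 0, u₂_comm 2 1]
  ring

end Prolongation

end PointField

lemma exists_jet (q : Base) (p : Fin 3 → ℝ) (s : Fin 3 → Fin 3 → ℝ) (hs : ∀ i j, s i j = s j i) :
    ∃ z : Jet 2, toBase z = q ∧ (∀ i, u₁ i (proj one_le_two z) = p i) ∧
      ∀ i j, u₂ i j z = s i j := by
  refine ⟨(q.1, fun α => match α.1 0, α.1 1, α.1 2 with
    | 0, 0, 0 => q.2
    | 1, 0, 0 => p 0
    | 0, 1, 0 => p 1
    | 0, 0, 1 => p 2
    | 2, 0, 0 => s 0 0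
    | 0, 2, 0 => s 1 1
    | 0, 0, 2 => s 2 2
    | 1, 1, 0 => s 0 1
    | 1, 0, 1 => s 0 2
    | 0, 1, 1 => s 1 2
    | _, _, _ => 0), rfl, fun i => ?_, fun i j => ?_⟩
  · fin_cases i <;> rfl
  · fin_cases i <;> fin_cases j <;> first | rfl | exact hs _ _

namespace PointField

/-- The contraction `τ - 2yξ + 2xφ` of `W` with the contact form `dt - 2y dx + 2x dy`, whose
kernel is spanned by `X` and `Y`; it generates the horizontal part of `W`. -/
def contact (W : PointField) (q : Base) : ℝ :=
  W.ξ 2 q - 2 * q.1 1 * W.ξ 0 q + 2 * q.1 0 * W.ξ 1 q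

/-- The determining equations of the Lie point symmetries of the critical Kohn-Laplace equation,
solved for the derivatives of the coefficients along the frame `X`, `Y`, `∂/∂u`. -/
structure DeterminingEquations (W : PointField) (M : Set Base) : Prop where
  smoothOn : W.SmoothOn M
  vertical_ξ : ∀ k, ∀ q ∈ M, ∂U (W.ξ k) q = 0
  frameX_ξ₀ : ∀ q ∈ M, ∂X (W.ξ 0) q = -∂U W.η q
  frameY_ξ₁ : ∀ q ∈ M, ∂Y (W.ξ 1) q = -∂U W.η q
  frameX_ξ₁ : ∀ q ∈ M, ∂X (W.ξ 1) q = -∂Y (W.ξ 0) q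
  frameX_contact : ∀ q ∈ M, ∂X W.contact q = 4 * W.ξ 1 q
  frameY_contact : ∀ q ∈ M, ∂Y W.contact q = -4 * W.ξ 0 q
  η_eq : ∀ q ∈ M, W.η q = q.2 * ∂U W.η q
  vertical_vertical_η : ∀ q ∈ M, ∂U (∂U W.η) q = 0
  baseKohnLaplacian_η : ∀ q ∈ M, ∂Δ W.η q = 0

section Necessity

variable {W : PointField} {M : Set Base} {q : Base}

lemma contact_smoothOn (hW : W.SmoothOn M) : ContDiffOn ℝ ∞ W.contact M := by
  have := hW.1
  unfold contact
  fun_prop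

lemma frameX_contact_eq (hM : IsOpen M) (hW : W.SmoothOn M) (hq : q ∈ M) :
    ∂X W.contact q =
      ∂X (W.ξ 2) q - 2 * q.1 1 * ∂X (W.ξ 0) q + 2 * q.1 0 * ∂X (W.ξ 1) q + 2 * W.ξ 1 q := by
  have h k := differentiableAt_of_mem hM (hW.1 k) hq
  unfold contact
  simp (disch := fun_prop) only [derivAlong_add, derivAlong_sub, derivAlong_mul,
    derivAlong_fun_const, derivAlong_coord, horizontal, frameX]
  simp
  ring

lemma frameY_contact_eq (hM : IsOpen M) (hW : W.SmoothOn M) (hq : q ∈ M) :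
    ∂Y W.contact q =
      ∂Y (W.ξ 2) q - 2 * q.1 1 * ∂Y (W.ξ 0) q + 2 * q.1 0 * ∂Y (W.ξ 1) q - 2 * W.ξ 0 q := by
  have h k := differentiableAt_of_mem hM (hW.1 k) hq
  unfold contact
  simp (disch := fun_prop) only [derivAlong_add, derivAlong_sub, derivAlong_mul,
    derivAlong_fun_const, derivAlong_coord, horizontal, frameY]
  simp
  ring

/-- The test jets have `u_x = p`, `u_y = u_t = 0` and second derivatives `u_xy = a`, `u_xt = b`,
`u_yy = c`, `u_yt = d`, `u_tt = 0`, the equation being solved for `u_xx`. -/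
lemma IsLiePointSymmetry.testJet_relation (hM : IsOpen M)
    (hW : W.IsLiePointSymmetry criticalEq M) (hq : q ∈ M) (p a b c d : ℝ) :
    ∂Δ W.η q + 2 * p * ∂X (∂U W.η) q + p ^ 2 * ∂U (∂U W.η) q - q.2 ^ 3 * ∂U W.η q
      - p * (∂Δ (W.ξ 0) q + 2 * p * ∂X (∂U (W.ξ 0)) q + p ^ 2 * ∂U (∂U (W.ξ 0)) q
        - q.2 ^ 3 * ∂U (W.ξ 0) q)
      - 2 * ((∂X (W.ξ 0) q + p * ∂U (W.ξ 0) q)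
          * (-c - 2 * q.1 1 * b + 4 * q.1 0 * d - q.2 ^ 3)
        + ∂Y (W.ξ 0) q * (a - 2 * q.1 0 * b)
        + (∂X (W.ξ 1) q + p * ∂U (W.ξ 1) q) * (a + 2 * q.1 1 * d)
        + ∂Y (W.ξ 1) q * (c - 2 * q.1 0 * d)
        + (∂X (W.ξ 2) q + p * ∂U (W.ξ 2) q) * b + ∂Y (W.ξ 2) q * d)
      + 4 * W.ξ 1 q * b - 4 * W.ξ 0 q * d + 3 * q.2 ^ 2 * W.η q = 0 := by
  obtain ⟨z, rfl, hp, hs⟩ := exists_jet q ![p, 0, 0]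
    ![![-(c + 4 * q.1 1 * b - 4 * q.1 0 * d + q.2 ^ 3), a, b], ![a, c, d], ![b, d, 0]]
    (by intro i j; fin_cases i <;> fin_cases j <;> rfl)
  have hz : z.1 = (toBase z).1 := rfl
  have hu : Δ u₀ z = -(toBase z).2 ^ 3 := by
    simp [kohnLaplacian_u₀, hs, hz]
    ring
  have hX : X u₀ (proj one_le_two z) = p := by simp [X_u₀, hp]
  have hY : Y u₀ (proj one_le_two z) = 0 := by simp [Y_u₀, hp]
  have key := hW.2 z hq (by rw [criticalEq_eq_kohnLaplacian, hu]; ring)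
  have hXξ k : X (fun w : Jet 0 => W.ξ k (toBase w)) (proj one_le_two z) =
      ∂X (W.ξ k) (toBase z) + X u₀ (proj one_le_two z) * ∂U (W.ξ k) (toBase z) :=
    X_comp_toBase (differentiableAt_of_mem hM (hW.1.1 k) hq)
  have hYξ k : Y (fun w : Jet 0 => W.ξ k (toBase w)) (proj one_le_two z) =
      ∂Y (W.ξ k) (toBase z) + Y u₀ (proj one_le_two z) * ∂U (W.ξ k) (toBase z) :=
    Y_comp_toBase (differentiableAt_of_mem hM (hW.1.1 k) hq)
  simp only [pr₂_criticalEq_eq hM hW.1 hq, kohnLaplacian_comp_toBase hM hW.1.2 hq,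
    kohnLaplacian_comp_toBase hM (hW.1.1 _) hq, hXξ, hYξ, X_u₁, Y_u₁, hu, hX, hY,
    Fin.sum_univ_three, hp, hs, hz] at key
  simp only [Matrix.cons_val] at key
  linear_combination key

lemma IsLiePointSymmetry.vertical_ξ (hM : IsOpen M) (hW : W.IsLiePointSymmetry criticalEq M)
    (hq : q ∈ M) (k : Fin 3) : ∂U (W.ξ k) q = 0 := by
  have G := hW.testJet_relation hM hq
  have h0 : ∂U (W.ξ 0) q = 0 := by
    linear_combination (G 1 0 0 1 0 - G 1 0 0 0 0 - G 0 0 0 1 0 + G 0 0 0 0 0) / 2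
  have h1 : ∂U (W.ξ 1) q = 0 := by
    linear_combination -(G 1 1 0 0 0 - G 1 0 0 0 0 - G 0 1 0 0 0 + G 0 0 0 0 0) / 2
  have h2 : ∂U (W.ξ 2) q = 0 := by
    linear_combination -(G 1 0 1 0 0 - G 1 0 0 0 0 - G 0 0 1 0 0 + G 0 0 0 0 0) / 2
      + 2 * q.1 1 * h0
  fin_cases k
  exacts [h0, h1, h2]

lemma IsLiePointSymmetry.vertical_vertical_η (hM : IsOpen M)
    (hW : W.IsLiePointSymmetry criticalEq M) (hq : q ∈ M) : ∂U (∂U W.η) q = 0 := by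
  have G := hW.testJet_relation hM hq
  have hX : ∂X (∂U (W.ξ 0)) q = 0 :=
    derivAlong_eq_zero_of_eqOn hM hq fun p hp => hW.vertical_ξ hM hp 0
  linear_combination (G 1 0 0 0 0 + G (-1) 0 0 0 0 - 2 * G 0 0 0 0 0) / 2 + 2 * hX

lemma IsLiePointSymmetry.η_eq (hM : IsOpen M) (hW : W.IsLiePointSymmetry criticalEq M)
    (hq : q ∈ M) :
    W.η q = q.2 * ∂U W.η q ∧ ∂U W.η q - 2 * ∂X (W.ξ 0) q = 3 * ∂U W.η q ∧ ∂Δ W.η q = 0 := by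
  have hξ := hW.1.1 0
  have hη := hW.1.2
  have hU : ContDiff ℝ ∞ fun _ : Base => ((0, 1) : Base) := contDiff_const
  have hUη := contDiffOn_derivAlong hM hU hη
  have hXξ := contDiffOn_derivAlong hM (contDiff_horizontal contDiff_frameX) hξ
  have laplacian : ∀ q ∈ M, ∂U (∂U (∂Δ W.η)) q = 0 := fun q hq => by
    rw [derivAlong_congr hM hq fun _ hp => derivAlong_vertical_baseKohnLaplacian hM hp hη,
      derivAlong_vertical_baseKohnLaplacian hM hq hUη]
    exact baseKohnLaplacian_eq_zero_of_eqOn hM hq fun p hp => hW.vertical_vertical_η hM hp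
  have coefficient : ∀ q ∈ M, ∂U (fun p => ∂U W.η p - 2 * ∂X (W.ξ 0) p) q = 0 := fun q hq => by
    have := differentiableAt_of_mem hM hUη hq
    have := differentiableAt_of_mem hM hXξ hq
    simp (disch := fun_prop) only [derivAlong_sub, derivAlong_mul, derivAlong_fun_const,
      derivAlong_vertical_horizontal hM hq contDiff_frameX hξ, hW.vertical_vertical_η hM hq,
      derivAlong_eq_zero_of_eqOn hM hq fun _ hp => hW.vertical_ξ hM hp 0, mul_zero, add_zero,
      sub_zero]
  refine eq_of_cubic_relation hM hU contDiff_snd.contDiffOn (contDiffOn_baseKohnLaplacian hM hη)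
    hη (hUη.sub (contDiffOn_const.mul hXξ)) (fun q _ => congrFun (derivAlong_snd _) q) laplacian
    (fun q hq => hW.vertical_vertical_η hM hq) coefficient (fun q hq => ?_) hq
  linear_combination hW.testJet_relation hM hq 0 0 0 0 0

lemma IsLiePointSymmetry.determiningEquations (hM : IsOpen M)
    (hW : W.IsLiePointSymmetry criticalEq M) : W.DeterminingEquations M := by
  have G {q} (hq : q ∈ M) := hW.testJet_relation hM hq
  have X₀ {q} (hq : q ∈ M) : ∂X (W.ξ 0) q = -∂U W.η q := by
    linear_combination -(hW.η_eq hM hq).2.1 / 2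
  have Y₁ {q} (hq : q ∈ M) : ∂Y (W.ξ 1) q = ∂X (W.ξ 0) q := by
    linear_combination -(G hq 0 0 0 1 0 - G hq 0 0 0 0 0) / 2
  have X₁ {q} (hq : q ∈ M) : ∂X (W.ξ 1) q = -∂Y (W.ξ 0) q := by
    linear_combination -(G hq 0 1 0 0 0 - G hq 0 0 0 0 0) / 2
  refine
    { smoothOn := hW.1
      vertical_ξ := fun k q hq => hW.vertical_ξ hM hq k
      frameX_ξ₀ := fun q hq => X₀ hq
      frameY_ξ₁ := fun q hq => (Y₁ hq).trans (X₀ hq)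
      frameX_ξ₁ := fun q hq => X₁ hq
      frameX_contact := fun q hq => ?_
      frameY_contact := fun q hq => ?_
      η_eq := fun q hq => (hW.η_eq hM hq).1
      vertical_vertical_η := fun q hq => hW.vertical_vertical_η hM hq
      baseKohnLaplacian_η := fun q hq => (hW.η_eq hM hq).2.2 }
  · linear_combination frameX_contact_eq hM hW.1 hq - (G hq 0 0 1 0 0 - G hq 0 0 0 0 0) / 2
      + 2 * q.1 0 * X₁ hq
  · linear_combination frameY_contact_eq hM hW.1 hq - (G hq 0 0 0 0 1 - G hq 0 0 0 0 0) / 2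
      - 2 * q.1 1 * X₁ hq + 4 * q.1 0 * Y₁ hq

end Necessity

/-- The potential `(u/2) ((Xη) X + (Yη) Y)` of a Lie point symmetry as a divergence symmetry of
the Kohn-Laplace Lagrangian, written in the coordinates `x`, `y`, `t`. -/
noncomputable def symmetryPotential (W : PointField) (i : Fin 3) (z : Jet 0) : ℝ :=
  (toBase z).2 / 2 * ∂X W.η (toBase z) * frameX z.1 i
    + (toBase z).2 / 2 * ∂Y W.η (toBase z) * frameY z.1 i

namespace DeterminingEquations

variable {W : PointField} {M : Set Base} {q : Base}

lemma differentiableAt_ξ (hM : IsOpen M) (h : W.DeterminingEquations M) (hq : q ∈ M) (k : Fin 3) :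
    DifferentiableAt ℝ (W.ξ k) q :=
  differentiableAt_of_mem hM (h.smoothOn.1 k) hq

lemma derivAlong_contact (hM : IsOpen M) (h : W.DeterminingEquations M) (hq : q ∈ M) :
    ∂[2] W.contact q = -2 * ∂U W.η q := by
  have XY : ∂X (∂Y W.contact) q = -4 * ∂X (W.ξ 0) q := by
    rw [derivAlong_congr hM hq h.frameY_contact,
      derivAlong_mul (by fun_prop) (h.differentiableAt_ξ hM hq 0), derivAlong_fun_const]
    ring
  have YX : ∂Y (∂X W.contact) q = 4 * ∂Y (W.ξ 1) q := by
    rw [derivAlong_congr hM hq h.frameX_contact,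
      derivAlong_mul (by fun_prop) (h.differentiableAt_ξ hM hq 1), derivAlong_fun_const]
    ring
  have bracket := derivAlong_frameX_frameY_sub hM hq (contact_smoothOn h.smoothOn)
  rw [XY, YX, h.frameX_ξ₀ q hq, h.frameY_ξ₁ q hq] at bracket
  linear_combination bracket / 4

lemma derivAlong_ξ₀ (hM : IsOpen M) (h : W.DeterminingEquations M) (hq : q ∈ M) :
    ∂[2] (W.ξ 0) q = ∂Y (∂U W.η) q / 2 := by
  have hη := differentiableAt_of_mem hM
    (contDiffOn_derivAlong hM (V := fun _ => ((0, 1) : Base)) contDiff_const h.smoothOn.2) hq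
  have comm := derivAlong_const_comm hM hq (contact_smoothOn h.smoothOn) 2 contDiff_frameY
    (by simp [fderiv_frameY])
  rw [derivAlong_congr hM hq h.frameY_contact,
    derivAlong_congr hM hq fun _ hp => h.derivAlong_contact hM hp,
    derivAlong_mul (by fun_prop) (h.differentiableAt_ξ hM hq 0), derivAlong_mul (by fun_prop) hη,
    derivAlong_fun_const, derivAlong_fun_const] at comm
  linear_combination -comm / 4

lemma derivAlong_ξ₁ (hM : IsOpen M) (h : W.DeterminingEquations M) (hq : q ∈ M) :
    ∂[2] (W.ξ 1) q = -∂X (∂U W.η) q / 2 := by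
  have hη := differentiableAt_of_mem hM
    (contDiffOn_derivAlong hM (V := fun _ => ((0, 1) : Base)) contDiff_const h.smoothOn.2) hq
  have comm := derivAlong_const_comm hM hq (contact_smoothOn h.smoothOn) 2 contDiff_frameX
    (by simp [fderiv_frameX])
  rw [derivAlong_congr hM hq h.frameX_contact,
    derivAlong_congr hM hq fun _ hp => h.derivAlong_contact hM hp,
    derivAlong_mul (by fun_prop) (h.differentiableAt_ξ hM hq 1), derivAlong_mul (by fun_prop) hη,
    derivAlong_fun_const, derivAlong_fun_const] at comm
  linear_combination comm / 4

lemma frameX_ξ₂ (hM : IsOpen M) (h : W.DeterminingEquations M) (hq : q ∈ M) :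
    ∂X (W.ξ 2) q = 2 * W.ξ 1 q + 2 * q.1 1 * ∂X (W.ξ 0) q - 2 * q.1 0 * ∂X (W.ξ 1) q := by
  linear_combination h.frameX_contact q hq - frameX_contact_eq hM h.smoothOn hq

lemma frameY_ξ₂ (hM : IsOpen M) (h : W.DeterminingEquations M) (hq : q ∈ M) :
    ∂Y (W.ξ 2) q = -2 * W.ξ 0 q + 2 * q.1 1 * ∂Y (W.ξ 0) q - 2 * q.1 0 * ∂Y (W.ξ 1) q := by
  linear_combination h.frameY_contact q hq - frameY_contact_eq hM h.smoothOn hq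

lemma baseKohnLaplacian_ξ₀ (hM : IsOpen M) (h : W.DeterminingEquations M) (hq : q ∈ M) :
    ∂Δ (W.ξ 0) q = 2 * ∂X (∂U W.η) q := by
  have XX := derivAlong_congr (V := horizontal frameX) hM hq h.frameX_ξ₀
  have YY := derivAlong_congr (V := horizontal frameY) hM hq fun _ hp =>
    neg_eq_iff_eq_neg.1 (h.frameX_ξ₁ _ hp).symm
  have XY := derivAlong_congr (V := horizontal frameX) hM hq h.frameY_ξ₁
  rw [derivAlong_fun_neg] at XX YY XY
  rw [baseKohnLaplacian]
  linear_combination XX + YY + derivAlong_frameX_frameY_sub hM hq (h.smoothOn.1 1) - XY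
    - 4 * h.derivAlong_ξ₁ hM hq

lemma baseKohnLaplacian_ξ₁ (hM : IsOpen M) (h : W.DeterminingEquations M) (hq : q ∈ M) :
    ∂Δ (W.ξ 1) q = 2 * ∂Y (∂U W.η) q := by
  have XX := derivAlong_congr (V := horizontal frameX) hM hq h.frameX_ξ₁
  have YY := derivAlong_congr (V := horizontal frameY) hM hq h.frameY_ξ₁
  have YX := derivAlong_congr (V := horizontal frameY) hM hq h.frameX_ξ₀
  rw [derivAlong_fun_neg] at XX YY YX
  rw [baseKohnLaplacian]
  linear_combination XX + YY - derivAlong_frameX_frameY_sub hM hq (h.smoothOn.1 0) - YX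
    + 4 * h.derivAlong_ξ₀ hM hq

lemma baseKohnLaplacian_ξ₂ (hM : IsOpen M) (h : W.DeterminingEquations M) (hq : q ∈ M) :
    ∂Δ (W.ξ 2) q = 2 * q.1 1 * ∂Δ (W.ξ 0) q - 2 * q.1 0 * ∂Δ (W.ξ 1) q := by
  have dξ := h.differentiableAt_ξ hM hq
  have dX k := differentiableAt_of_mem hM
    (contDiffOn_derivAlong hM (contDiff_horizontal contDiff_frameX) (h.smoothOn.1 k)) hq
  have dY k := differentiableAt_of_mem hM
    (contDiffOn_derivAlong hM (contDiff_horizontal contDiff_frameY) (h.smoothOn.1 k)) hq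
  unfold baseKohnLaplacian
  rw [derivAlong_congr hM hq fun _ hp => h.frameX_ξ₂ hM hp,
    derivAlong_congr hM hq fun _ hp => h.frameY_ξ₂ hM hp]
  simp (disch := fun_prop) only [derivAlong_add, derivAlong_sub, derivAlong_mul,
    derivAlong_fun_const, derivAlong_coord, horizontal, frameX, frameY]
  simp
  ring

lemma pr₂_criticalEq (hM : IsOpen M) (h : W.DeterminingEquations M) {z : Jet 2}
    (hz : toBase z ∈ M) : W.pr₂ criticalEq z = 3 * ∂U W.η (toBase z) * criticalEq z := by
  have hXξ k : X (fun w : Jet 0 => W.ξ k (toBase w)) (proj one_le_two z) =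
      ∂X (W.ξ k) (toBase z) + X u₀ (proj one_le_two z) * ∂U (W.ξ k) (toBase z) :=
    X_comp_toBase (h.differentiableAt_ξ hM hz k)
  have hYξ k : Y (fun w : Jet 0 => W.ξ k (toBase w)) (proj one_le_two z) =
      ∂Y (W.ξ k) (toBase z) + Y u₀ (proj one_le_two z) * ∂U (W.ξ k) (toBase z) :=
    Y_comp_toBase (h.differentiableAt_ξ hM hz k)
  have U_ξ {V : Base → Base} k : derivAlong V (∂U (W.ξ k)) (toBase z) = 0 :=
    derivAlong_eq_zero_of_eqOn hM hz (h.vertical_ξ k)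
  have hz₁ : (toBase z).1 = z.1 := rfl
  rw [pr₂_criticalEq_eq hM h.smoothOn hz, kohnLaplacian_comp_toBase hM h.smoothOn.2 hz,
    criticalEq_eq_kohnLaplacian, kohnLaplacian_u₀]
  simp only [kohnLaplacian_comp_toBase hM (h.smoothOn.1 _) hz, hXξ, hYξ, U_ξ, X_u₁, Y_u₁, X_u₀,
    Y_u₀, Fin.sum_univ_three, h.baseKohnLaplacian_ξ₂ hM hz, h.baseKohnLaplacian_ξ₁ hM hz,
    h.baseKohnLaplacian_ξ₀ hM hz, h.frameX_ξ₂ hM hz, h.frameY_ξ₂ hM hz, h.frameX_ξ₀ _ hz,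
    h.frameX_ξ₁ _ hz, h.frameY_ξ₁ _ hz, h.vertical_ξ _ _ hz, h.vertical_vertical_η _ hz,
    h.baseKohnLaplacian_η _ hz, hz₁, u₂_comm 1 0, u₂_comm 2 0, u₂_comm 2 1]
  change _ + 3 * (toBase z).2 ^ 2 * W.η (toBase z) = _
  rw [h.η_eq _ hz]
  simp only [proj]
  ring

lemma isLiePointSymmetry (hM : IsOpen M) (h : W.DeterminingEquations M) :
    W.IsLiePointSymmetry criticalEq M :=
  ⟨h.smoothOn, fun z hz hF => by rw [h.pr₂_criticalEq hM hz, hF, mul_zero]⟩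

lemma sum_Dξ_eq (hM : IsOpen M) (h : W.DeterminingEquations M) {z : Jet 1} (hz : toBase z ∈ M) :
    ∑ i, W.Dξ i i z = -4 * ∂U W.η (toBase z) := by
  have dξ := h.differentiableAt_ξ hM hz
  have contact_eq := h.derivAlong_contact hM hz
  unfold contact at contact_eq
  simp (disch := fun_prop) only [derivAlong_add, derivAlong_sub, derivAlong_mul,
    derivAlong_fun_const, derivAlong_coord, horizontal] at contact_eq
  simp only [Dξ, D_comp_toBase (dξ _), Fin.sum_univ_three, h.vertical_ξ _ _ hz]
  have X₀ := h.frameX_ξ₀ _ hz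
  have Y₁ := h.frameY_ξ₁ _ hz
  rw [derivAlong_frameX_eq] at X₀
  rw [derivAlong_frameY_eq] at Y₁
  simp at contact_eq
  linear_combination X₀ + Y₁ + contact_eq

lemma variationOf_lagrangian (hM : IsOpen M) (h : W.DeterminingEquations M) {z : Jet 1}
    (hz : toBase z ∈ M) :
    W.variationOf lagrangian z = X u₀ z * ∂X W.η (toBase z) + Y u₀ z * ∂Y W.η (toBase z) := by
  have dη := differentiableAt_of_mem hM h.smoothOn.2 hz
  have hz₁ : (toBase z).1 = z.1 := rfl
  have hz₂ : proj (Nat.le_add_left 1 0) z = z := rfl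
  have X_ξ₀ := h.frameX_ξ₀ _ hz
  have Y_ξ₁ := h.frameY_ξ₁ _ hz
  have X_ξ₁ := h.frameX_ξ₁ _ hz
  have X_ξ₂ := h.frameX_ξ₂ hM hz
  have Y_ξ₂ := h.frameY_ξ₂ hM hz
  rw [variationOf, pr₁_lagrangian, h.sum_Dξ_eq hM hz, lagrangian]
  simp only [η₁, Dξ, D_comp_toBase (h.differentiableAt_ξ hM hz _), D_comp_toBase dη,
    Fin.sum_univ_three, h.vertical_ξ _ _ hz, X_u₀, Y_u₀, derivAlong_frameX_eq,
    derivAlong_frameY_eq, hz₁, hz₂] at X_ξ₀ Y_ξ₁ X_ξ₁ X_ξ₂ Y_ξ₂ ⊢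
  linear_combination
    -(u₁ 0 z + 2 * z.1 1 * u₁ 2 z) * ((u₁ 0 z + 2 * z.1 1 * u₁ 2 z) * X_ξ₀
        + (u₁ 1 z - 2 * z.1 0 * u₁ 2 z) * X_ξ₁ + u₁ 2 z * X_ξ₂)
      - (u₁ 1 z - 2 * z.1 0 * u₁ 2 z) * ((u₁ 1 z - 2 * z.1 0 * u₁ 2 z) * Y_ξ₁ + u₁ 2 z * Y_ξ₂)
      - (toBase z).2 ^ 3 * h.η_eq _ hz

lemma isVariationalSymmetry (hM : IsOpen M) (h : W.DeterminingEquations M)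
    (hX : ∀ q ∈ M, ∂X W.η q = 0) (hY : ∀ q ∈ M, ∂Y W.η q = 0) :
    W.IsVariationalSymmetry lagrangian M :=
  ⟨h.smoothOn, fun z hz => by
    rw [h.variationOf_lagrangian hM hz, hX _ hz, hY _ hz, mul_zero, mul_zero, add_zero]⟩

lemma frame_η (hM : IsOpen M) (h : W.DeterminingEquations M) (hq : q ∈ M)
    {a : (Fin 3 → ℝ) → Fin 3 → ℝ} (ha : ContDiff ℝ ∞ a) :
    derivAlong (horizontal a) W.η q = q.2 * ∂U (derivAlong (horizontal a) W.η) q := by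
  have hη := contDiffOn_derivAlong hM (V := fun _ => ((0, 1) : Base)) contDiff_const h.smoothOn.2
  rw [derivAlong_vertical_horizontal hM hq ha h.smoothOn.2, derivAlong_congr hM hq h.η_eq,
    derivAlong_mul differentiableAt_snd (differentiableAt_of_mem hM hη hq), derivAlong_snd]
  simp only [horizontal, mul_zero, add_zero]

lemma contDiffOn_symmetryPotential (hM : IsOpen M) (hW : W.SmoothOn M) (i : Fin 3) :
    ContDiffOn ℝ ∞ (W.symmetryPotential i) (jetsOver 0 M) := by
  have smooth {a : (Fin 3 → ℝ) → Fin 3 → ℝ} (ha : ContDiff ℝ ∞ a) :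
      ContDiffOn ℝ ∞ (fun q => q.2 / 2 * derivAlong (horizontal a) W.η q * a q.1 i) M := by
    have hη := contDiffOn_derivAlong hM (contDiff_horizontal ha) hW.2
    fun_prop
  exact contDiffOn_comp_toBase (n := 0) ((smooth contDiff_frameX).add (smooth contDiff_frameY))

lemma totalAlong_half_mul_frame_η (hM : IsOpen M) (h : W.DeterminingEquations M) {z : Jet 1}
    (hz : toBase z ∈ M) {a : (Fin 3 → ℝ) → Fin 3 → ℝ} (ha : ContDiff ℝ ∞ a) :
    totalAlong a
        (fun w : Jet 0 => (toBase w).2 / 2 * derivAlong (horizontal a) W.η (toBase w)) z =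
      (toBase z).2 / 2 * derivAlong (horizontal a) (derivAlong (horizontal a) W.η) (toBase z)
        + totalAlong a u₀ z * derivAlong (horizontal a) W.η (toBase z) := by
  have hη := differentiableAt_of_mem hM
    (contDiffOn_derivAlong hM (contDiff_horizontal ha) h.smoothOn.2) hz
  have hu : DifferentiableAt ℝ (fun q : Base => q.2 / 2) (toBase z) := by fun_prop
  have du {V : Base → Base} :
      derivAlong V (fun q => q.2 / 2) (toBase z) = (V (toBase z)).2 / 2 := by
    simp only [div_eq_mul_inv]
    rw [derivAlong_mul differentiableAt_snd (by fun_prop), derivAlong_fun_const, derivAlong_snd]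
    ring
  rw [totalAlong_comp_toBase (g := fun q => q.2 / 2 * derivAlong (horizontal a) W.η q)
    (hu.fun_mul hη), derivAlong_mul hu hη, derivAlong_mul hu hη, du, du]
  change _ + totalAlong a u₀ z * _ = _
  simp only [horizontal]
  linear_combination -totalAlong a u₀ z / 2 * h.frame_η hM hz ha

lemma isDivergenceSymmetryWith (hM : IsOpen M) (h : W.DeterminingEquations M) :
    W.IsDivergenceSymmetryWith lagrangian M W.symmetryPotential := by
  refine ⟨h.smoothOn, contDiffOn_symmetryPotential hM h.smoothOn, fun z hz => ?_⟩
  have differentiable {a : (Fin 3 → ℝ) → Fin 3 → ℝ} (ha : ContDiff ℝ ∞ a) :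
      DifferentiableAt ℝ
        (fun w : Jet 0 => (toBase w).2 / 2 * derivAlong (horizontal a) W.η (toBase w))
        (proj (Nat.le_succ 0) z) := by
    have hη := contDiffOn_derivAlong hM (contDiff_horizontal ha) h.smoothOn.2
    exact differentiableAt_comp_toBase hM (g := fun q => q.2 / 2 * derivAlong _ _ q)
      (by fun_prop) hz
  calc W.variationOf lagrangian z
      = X u₀ z * ∂X W.η (toBase z) + Y u₀ z * ∂Y W.η (toBase z) := h.variationOf_lagrangian hM hz
    _ = X (fun w : Jet 0 => (toBase w).2 / 2 * ∂X W.η (toBase w)) z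
        + Y (fun w : Jet 0 => (toBase w).2 / 2 * ∂Y W.η (toBase w)) z := by
      have laplace : ∂Δ W.η (toBase z) = 0 := h.baseKohnLaplacian_η _ hz
      rw [baseKohnLaplacian] at laplace
      rw [X_eq_totalAlong, X_eq_totalAlong, Y_eq_totalAlong, Y_eq_totalAlong,
        h.totalAlong_half_mul_frame_η hM hz contDiff_frameX,
        h.totalAlong_half_mul_frame_η hM hz contDiff_frameY]
      linear_combination -(toBase z).2 / 2 * laplace
    _ = Div W.symmetryPotential z :=
      (Div_frame (differentiable contDiff_frameX) (differentiable contDiff_frameY)).symm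

end DeterminingEquations

end PointField

section Generators

attribute [local simp] fieldT fieldR fieldXt fieldYt fieldZ fieldV₁ fieldV₂ fieldV₃ field
  horizontal frameX frameY derivAlong_coord derivAlong_snd derivAlong_fun_const derivAlong_fun_neg
  derivAlong_add derivAlong_sub derivAlong_mul derivAlong_fun_mul derivAlong_pow

lemma frame_η_eq_zero {W : PointField} (hW : W ∈ [fieldT, fieldR, fieldXt, fieldYt, fieldZ]) :
    (∂X W.η = fun _ => 0) ∧ ∂Y W.η = fun _ => 0 := by
  revert W
  simp

lemma smoothOn_generators {W : PointField} (hW : W ∈ [fieldT, fieldR, fieldXt, fieldYt, fieldZ,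
    fieldV₁, fieldV₂, fieldV₃]) : W.SmoothOn Set.univ := by
  revert W
  simp only [List.forall_mem_cons, List.not_mem_nil, implies_true, and_true,
    PointField.SmoothOn, contDiffOn_univ, Fin.forall_fin_succ, IsEmpty.forall_iff, fieldT, fieldR,
    fieldXt, fieldYt, fieldZ, fieldV₁, fieldV₂, fieldV₃, field, Fin.succ_zero_eq_one,
    Fin.succ_one_eq_two, Matrix.cons_val]
  and_intros <;> fun_prop

lemma determiningEquations_generators {W : PointField} (hW : W ∈ [fieldT, fieldR, fieldXt,
    fieldYt, fieldZ, fieldV₁, fieldV₂, fieldV₃]) : W.DeterminingEquations Set.univ := by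
  have smooth := smoothOn_generators hW
  refine ⟨smooth, ?_, ?_, ?_, ?_,
    fun q hq => (PointField.frameX_contact_eq isOpen_univ smooth hq).trans ?_,
    fun q hq => (PointField.frameY_contact_eq isOpen_univ smooth hq).trans ?_, ?_, ?_, ?_⟩
  all_goals
    clear smooth
    revert W
    simp only [List.forall_mem_cons, List.not_mem_nil, IsEmpty.forall_iff, implies_true, and_true,
      Fin.forall_fin_succ]
    and_intros
  all_goals
    intros
    simp (disch := fun_prop) [baseKohnLaplacian]
  all_goals ring

lemma symmetryPotential_fieldV₁ : fieldV₁.symmetryPotential = potentialA := by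
  funext i z
  unfold PointField.symmetryPotential potentialA potential u₀ toBase
  fin_cases i <;> simp (disch := fun_prop) <;> ring

lemma symmetryPotential_fieldV₂ : fieldV₂.symmetryPotential = potentialB := by
  funext i z
  unfold PointField.symmetryPotential potentialB potential u₀ toBase
  fin_cases i <;> simp (disch := fun_prop) <;> ring

lemma symmetryPotential_fieldV₃ : fieldV₃.symmetryPotential = potentialC := by
  funext i z
  unfold PointField.symmetryPotential potentialC potential u₀ toBase
  fin_cases i <;> simp (disch := fun_prop) <;> ring

end Generators

end KohnLaplace

theorem theorem2 :
    -- every Lie point symmetry, on any open set `M` of `(x, y, t, u)`, is a divergence symmetry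
    (∀ (M : Set KohnLaplace.Base), IsOpen M → ∀ W : KohnLaplace.PointField,
      W.IsLiePointSymmetry KohnLaplace.criticalEq M →
        W.IsDivergenceSymmetry KohnLaplace.lagrangian M) ∧
    -- the eight generators are Lie point symmetries
    (∀ W ∈ [KohnLaplace.fieldT, KohnLaplace.fieldR, KohnLaplace.fieldXt, KohnLaplace.fieldYt,
        KohnLaplace.fieldZ, KohnLaplace.fieldV₁, KohnLaplace.fieldV₂, KohnLaplace.fieldV₃],
      W.IsLiePointSymmetry KohnLaplace.criticalEq Set.univ) ∧
    -- five of them are variational symmetries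
    (∀ W ∈ [KohnLaplace.fieldT, KohnLaplace.fieldR, KohnLaplace.fieldXt, KohnLaplace.fieldYt,
        KohnLaplace.fieldZ],
      W.IsVariationalSymmetry KohnLaplace.lagrangian Set.univ) ∧
    -- the other three are divergence symmetries with the potentials `A`, `B`, `C`
    KohnLaplace.fieldV₁.IsDivergenceSymmetryWith KohnLaplace.lagrangian Set.univ
      KohnLaplace.potentialA ∧
    KohnLaplace.fieldV₂.IsDivergenceSymmetryWith KohnLaplace.lagrangian Set.univ
      KohnLaplace.potentialB ∧
    KohnLaplace.fieldV₃.IsDivergenceSymmetryWith KohnLaplace.lagrangian Set.univ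
      KohnLaplace.potentialC := by
  have determining := @KohnLaplace.determiningEquations_generators
  refine ⟨fun M hM W hW => ⟨0, W.symmetryPotential, ?_⟩, fun W hW => ?_, fun W hW => ?_, ?_, ?_, ?_⟩
  · exact (hW.determiningEquations hM).isDivergenceSymmetryWith hM
  · exact (determining hW).isLiePointSymmetry isOpen_univ
  · have ⟨hX, hY⟩ := KohnLaplace.frame_η_eq_zero hW
    exact (determining (List.mem_append_left _ hW)).isVariationalSymmetry isOpen_univ
      (fun q _ => congrFun hX q) fun q _ => congrFun hY q
  · rw [← KohnLaplace.symmetryPotential_fieldV₁]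
    exact (determining (by simp)).isDivergenceSymmetryWith isOpen_univ
  · rw [← KohnLaplace.symmetryPotential_fieldV₂]
    exact (determining (by simp)).isDivergenceSymmetryWith isOpen_univ
  · rw [← KohnLaplace.symmetryPotential_fieldV₃]
    exact (determining (by simp)).isDivergenceSymmetryWith isOpen_univ
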